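/- Let $a,b$ be continuous real functions on $(0,1)$ with $b>0$, and put $$s(x)=\exp\Big(-\int_{1/2}^x\frac{2a(y)}{b(y)}\,dy\Big),\qquad m=\frac1{s\,b},\qquad S(x)=\int_{1/2}^x s(y)\,dy,\qquad M(x)=\int_{1/2}^x m(y)\,dy .$$ With $N(0)=\int_{(0,1/2]}[S(1/2)-S(\eta)]\,dM(\eta)$ and $\Sigma(0)=\int_{(0,1/2]}[M(1/2)-M(\eta)]\,dS(\eta)$, the boundary $0$ is called regular if $N(0)<\infty$ and $\Sigma(0)<\infty$, and entrance if $N(0)<\infty$ and $\Sigma(0)=\infty$; similarly at $1$. Suppose each of the two boundary points is regular or entrance. Let $\mathcal D_A$ be the set of $f\in C[0,1]\cap C^2(0,1)$ for which $Af=\tfrac12 b f''+a f'$ extends to an element of $C[0,1]$ and for which $f'(x)/s(x)\to0$ as $x$ tends to any regular boundary point (instantaneous reflection; no condition is imposed at an entrance boundary point). Let $(T_t)_{t\ge0}$ be a Feller semigroup on $C[0,1]$ whose infinitesimal generator is $(A,\mathcal D_A)$, and let $X$ be a diffusion on $[0,1]$ (a Markov process with continuous paths) with semigroup $(T_t)$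 and initial distribution $\Pi_0$; write $\Pi_t$ for the law of $X_t$. Let $\Pi$ be the probability measure on $[0,1]$ obtained by normalizing the speed measure $m(y)\,dy$ on $(0,1)$, let $\Pi^{(x)}$ be $\Pi$ conditioned to $(0,x]$ for $0<x\le1$, let $\Pi^{(0)}=\delta_0$, and let $(\Lambda f)(x)=\int f\,d\Pi^{(x)}$. Let $X^*$ be a strong stationary dual of $X$, that is, a Feller diffusion on $[0,1]$ (with continuous paths) with infinitesimal generator $(A^*,\mathcal D_{A^*})$ and initial distribution $\Pi_0^*$ such that $\Lambda$ maps $\mathcal D_A$ into $\mathcal D_{A^*}$, $\Lambda A=A^*\Lambda$ on $\mathcal D_A$, and $\int f\,d\Pi_0=\int\Lambda f\,d\Pi_0^*$ for all bounded Borel functions $f$ on $[0,1]$. Let $T_1^*=\inf\{t\ge0: X_t^*=1\}$ (with $\inf\emptyset=\infty$). Then $\Pi$ is a stationary distribution of $X$, and for every $t>0$ one has $\Pi_t\ll\Pi$ and $$\operatorname{sep}(t):=1-\operatorname*{ess\,inf}_{\Pi}\frac{d\Pi_t}{d\Pi}=\mathbb P(T_1^*>t)=1-\mathbb P(X_t^*=1).$$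 -/

import Mathlib

open Set Filter Topology MeasureTheory ProbabilityTheory
open scoped NNReal ENNReal

noncomputable section

namespace SSD

/-! ### Feller semigroups on `C([0,1])` and the processes they govern -/

/-- A (conservative) Feller semigroup on `C([0,1])`. -/
structure FellerSemigroup where
  /-- the transition operator `T_t` -/
  op : ℝ≥0 → (C(unitInterval, ℝ) →L[ℝ] C(unitInterval, ℝ))
  op_zero : op 0 = ContinuousLinearMap.id ℝ C(unitInterval, ℝ)
  op_add : ∀ s t : ℝ≥0, op (s + t) = (op s).comp (op t)
  op_one : ∀ t : ℝ≥0, op t 1 = 1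
  op_nonneg : ∀ (t : ℝ≥0) (f : C(unitInterval, ℝ)), 0 ≤ f → 0 ≤ op t f
  continuous_zero : ∀ f : C(unitInterval, ℝ), Tendsto (fun t : ℝ≥0 => op t f) (𝓝 0) (𝓝 f)

/-- The graph of the infinitesimal generator of `T`: `f` lies in the domain of the generator and the
generator maps `f` to `g`, i.e. `(T_t f - f) / t → g` uniformly as `t ↓ 0`. -/
def FellerSemigroup.Generator (T : FellerSemigroup) (f g : C(unitInterval, ℝ)) : Prop :=
  Tendsto (fun t : ℝ≥0 => (t : ℝ)⁻¹ • (T.op t f - f)) (𝓝[>] 0) (𝓝 g)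

/-- `X` is, under `P`, a Feller diffusion on `[0,1]` with transition semigroup `T`: it has continuous
paths and is Markov for its own filtration with transition operators `T_t`. Its initial
distribution is `P.map (X 0)`. -/
structure IsFellerDiffusion {Ω : Type*} [MeasurableSpace Ω] (T : FellerSemigroup) (P : Measure Ω)
    (X : ℝ≥0 → Ω → unitInterval) : Prop where
  measurable : ∀ t, Measurable (X t)
  continuous : ∀ ω, Continuous fun t => X t ω
  markov : ∀ (s t : ℝ≥0) (f : C(unitInterval, ℝ)),
    P[fun ω => f (X (s + t) ω) |
        Filtration.natural X (fun i => (measurable i).stronglyMeasurable) s]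
      =ᵐ[P] fun ω => T.op t f (X s ω)

/-- `μ` is a stationary (invariant) distribution for the semigroup `T`. -/
def IsStationary (T : FellerSemigroup) (μ : Measure unitInterval) : Prop :=
  IsProbabilityMeasure μ ∧
    ∀ (t : ℝ≥0) (f : C(unitInterval, ℝ)), ∫ x, T.op t f x ∂μ = ∫ x, f x ∂μ

/-! ### Scale, speed and Feller's boundary classification

Throughout, `a` is the drift and `b` the infinitesimal variance on the open interval `(0,1)`; the
base point in the indefinite integrals is `1/2`. -/

/-- The scale density `s(x) = exp (- ∫^x 2 a / b)`. -/
def scaleDensity (a b : ℝ → ℝ) (x : ℝ) : ℝ :=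
  Real.exp (-∫ y in (1 / 2 : ℝ)..x, 2 * a y / b y)

/-- The scale function `S`, with `S' = s`. -/
def scaleFn (a b : ℝ → ℝ) (x : ℝ) : ℝ :=
  ∫ y in (1 / 2 : ℝ)..x, scaleDensity a b y

/-- The speed density `m = 1 / (s b)`. -/
def speedDensity (a b : ℝ → ℝ) (x : ℝ) : ℝ :=
  (scaleDensity a b x * b x)⁻¹

/-- The speed function `M`, with `M' = m`. -/
def speedFn (a b : ℝ → ℝ) (x : ℝ) : ℝ :=
  ∫ y in (1 / 2 : ℝ)..x, speedDensity a b y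

/-- `N(0) = ∫_{(0,x]} [S(x) - S(η)] M(dη)` with `x = 1/2`. -/
def bdryN0 (a b : ℝ → ℝ) : ℝ≥0∞ :=
  ∫⁻ η in Ioc (0 : ℝ) (1 / 2),
    ENNReal.ofReal ((scaleFn a b (1 / 2) - scaleFn a b η) * speedDensity a b η)

/-- `Σ(0) = ∫_{(0,x]} [M(x) - M(η)] dS(η)` with `x = 1/2`. -/
def bdrySigma0 (a b : ℝ → ℝ) : ℝ≥0∞ :=
  ∫⁻ η in Ioc (0 : ℝ) (1 / 2),
    ENNReal.ofReal ((speedFn a b (1 / 2) - speedFn a b η) * scaleDensity a b η)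

/-- `N(1) = ∫_{[x,1)} [S(η) - S(x)] M(dη)` with `x = 1/2`. -/
def bdryN1 (a b : ℝ → ℝ) : ℝ≥0∞ :=
  ∫⁻ η in Ico (1 / 2 : ℝ) 1,
    ENNReal.ofReal ((scaleFn a b η - scaleFn a b (1 / 2)) * speedDensity a b η)

/-- `Σ(1) = ∫_{[x,1)} [M(η) - M(x)] dS(η)` with `x = 1/2`. -/
def bdrySigma1 (a b : ℝ → ℝ) : ℝ≥0∞ :=
  ∫⁻ η in Ico (1 / 2 : ℝ) 1,
    ENNReal.ofReal ((speedFn a b η - speedFn a b (1 / 2)) * scaleDensity a b η)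

/-- `0` is a regular boundary. -/
def IsRegular0 (a b : ℝ → ℝ) : Prop := bdryN0 a b < ∞ ∧ bdrySigma0 a b < ∞

/-- `0` is an entrance boundary. -/
def IsEntrance0 (a b : ℝ → ℝ) : Prop := bdryN0 a b < ∞ ∧ bdrySigma0 a b = ∞

/-- `1` is a regular boundary. -/
def IsRegular1 (a b : ℝ → ℝ) : Prop := bdryN1 a b < ∞ ∧ bdrySigma1 a b < ∞

/-- `1` is an entrance boundary. -/
def IsEntrance1 (a b : ℝ → ℝ) : Prop := bdryN1 a b < ∞ ∧ bdrySigma1 a b = ∞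

/-! ### The primal diffusion -/

/-- The graph of the operator `A = (1/2) b d²/dx² + a d/dx` on its domain `D_A`: `f ∈ D_A` and
`A f = g`. Here `f, g ∈ C([0,1])`, `f ∈ C²(0,1)`, and at a regular boundary point the
(instantaneous) reflection condition `df/dS = 0` is imposed, whereas at an entrance boundary point
there is no boundary condition. -/
structure MemGraph (a b : ℝ → ℝ) (f g : C(unitInterval, ℝ)) : Prop where
  contDiffOn : ContDiffOn ℝ 2 (IccExtend zero_le_one f) (Ioo (0 : ℝ) 1)
  eq_on_interior : ∀ x : unitInterval, 0 < (x : ℝ) → (x : ℝ) < 1 →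
    g x = 1 / 2 * b x * deriv (deriv (IccExtend zero_le_one f)) x
      + a x * deriv (IccExtend zero_le_one f) x
  reflecting_zero : IsRegular0 a b →
    Tendsto (fun x : ℝ => deriv (IccExtend zero_le_one f) x / scaleDensity a b x) (𝓝[>] 0) (𝓝 0)
  reflecting_one : IsRegular1 a b →
    Tendsto (fun x : ℝ => deriv (IccExtend zero_le_one f) x / scaleDensity a b x) (𝓝[<] 1) (𝓝 0)

/-- `T` is the transition semigroup of the regular diffusion on `[0,1]` with drift `a` and
infinitesimal variance `b`, each boundary point being either instantaneously reflecting or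
entrance: its infinitesimal generator is the operator `A` with domain `D_A`. -/
structure IsReflectingOrEntrance (a b : ℝ → ℝ) (T : FellerSemigroup) : Prop where
  drift_continuousOn : ContinuousOn a (Ioo (0 : ℝ) 1)
  variance_continuousOn : ContinuousOn b (Ioo (0 : ℝ) 1)
  variance_pos : ∀ x ∈ Ioo (0 : ℝ) 1, 0 < b x
  boundary_zero : IsRegular0 a b ∨ IsEntrance0 a b
  boundary_one : IsRegular1 a b ∨ IsEntrance1 a b
  generator_iff : ∀ f g : C(unitInterval, ℝ), T.Generator f g ↔ MemGraph a b f g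

/-- The speed measure, with density `m` on `(0,1)`, as a measure on `[0,1]`. -/
def speedMeasure (a b : ℝ → ℝ) : Measure unitInterval :=
  Measure.comap Subtype.val
    ((volume.restrict (Ioo (0 : ℝ) 1)).withDensity fun x => ENNReal.ofReal (speedDensity a b x))

/-- The stationary distribution `Π`: the speed measure normalized to a probability measure. -/
def stationaryMeasure (a b : ℝ → ℝ) : Measure unitInterval :=
  (speedMeasure a b univ)⁻¹ • speedMeasure a b

/-! ### Strong stationary duality -/

/-- The distribution `Π^{(x)}`: `Π` conditioned to `(0,x]` when `x > 0`, and `δ_0` when `x = 0`. -/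
def truncated (Pi : Measure unitInterval) (x : unitInterval) : Measure unitInterval :=
  if x = 0 then Measure.dirac 0 else ProbabilityTheory.cond Pi (Ioc 0 x)

/-- The link operator `(Λ f)(x) = ∫ f dΠ^{(x)}`. -/
def link (Pi : Measure unitInterval) (f : unitInterval → ℝ) (x : unitInterval) : ℝ :=
  ∫ y, f y ∂(truncated Pi x)

/-- A diffusion with semigroup `T'` and initial distribution `ν` is a strong stationary dual of a
diffusion with semigroup `T`, stationary distribution `Pi` and initial distribution `μ`. -/
structure IsStrongStationaryDual (T T' : FellerSemigroup) (Pi μ ν : Measure unitInterval) :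
    Prop where
  /-- `Λ` maps `D_A` into `D_{A*}`, and `Λ A = A* Λ` on `D_A`. -/
  generator_link : ∀ f g : C(unitInterval, ℝ), T.Generator f g →
    ∃ F G : C(unitInterval, ℝ), (F : unitInterval → ℝ) = link Pi f ∧
      (G : unitInterval → ℝ) = link Pi g ∧ T'.Generator F G
  initial_link : ∀ f : unitInterval → ℝ, Measurable f → (∃ C, ∀ x, |f x| ≤ C) →
    ∫ x, f x ∂μ = ∫ x, link Pi f x ∂ν

/-- The separation `1 - ess inf_Π (dμ/dΠ)` of `μ` from `Π` (meant for `μ ≪ Π`). -/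
def separation (μ Pi : Measure unitInterval) : ℝ :=
  1 - (essInf (μ.rnDeriv Pi) Pi).toReal

end SSD

end

/-! The intertwining `ΛA = A*Λ` of generators passes to the semigroups, `T'_t Λ = Λ T_t`
(`FellerSemigroup.intertwining`). With the initial condition this says that Π_t is the mixture ∫
Π^{(x)} Π*_t(dx) (`eq_bind_truncated`). If Π*_t does not charge 0, this mixture has Π-density y ↦
∫_{x ≥ y} Π(0,x]⁻¹ Π*_t(dx), which decreases to Π*_t{1} as y ↑ 1. Hence the essential infimum is
Π*_t{1} (`essInf_rnDeriv_bind_truncated`). Two facts remain: 1 is absorbing for the dual, so that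
{X*_t = 1} and {T*_1 ≤ t} agree almost surely, and Π*_t{0} = 0 for t > 0.

Absorption (`dual_ae_eq_one`): with f(x) = x, the function g = Λf(1) - Λf is positive off 1, and
T'_r g(1) = Λf(1) - ΛT_r f(1) = 0 because Λ at 1 is integration against the stationary Π. So g(X*_t)
= 0 almost surely once 1 has been visited.

The other facts come from the equation A f = h. Finiteness of N(0) and N(1) makes it solvable for
every continuous h with Π-mean zero, and the solution is uniformly small when h is bounded and small
in L¹(Π) (`exists_generator_seq`). Stationarity follows because a nonzero constant cannot lie in the
range of a generator (`isStationary`). Applied to spikes at 0, the estimate shows that the primal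
diffusion started at 0 spends no time there (`exists_tendsto_op_spike`), and the link transfers this
to the dual (`dual_law_zero`). -/

namespace SSD

/-! ### Semigroup theory -/

namespace FellerSemigroup

variable (T : FellerSemigroup)

lemma op_mono (t : ℝ≥0) {f g : C(unitInterval, ℝ)} (h : f ≤ g) : T.op t f ≤ T.op t g := by
  have := T.op_nonneg t (g - f) (sub_nonneg.2 h)
  rwa [map_sub, sub_nonneg] at this

lemma norm_op_le (t : ℝ≥0) (f : C(unitInterval, ℝ)) : ‖T.op t f‖ ≤ ‖f‖ := by
  have h1 : f ≤ ‖f‖ • (1 : C(unitInterval, ℝ)) := fun x => by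
    simpa using (le_abs_self _).trans (f.norm_coe_le_norm x)
  have h2 : -(‖f‖ • (1 : C(unitInterval, ℝ))) ≤ f := fun x => by
    simpa using neg_le.1 ((neg_le_abs _).trans (f.norm_coe_le_norm x))
  have h1' := T.op_mono t h1
  have h2' := T.op_mono t h2
  rw [map_neg] at h2'
  rw [map_smul, T.op_one] at h1' h2'
  refine (ContinuousMap.norm_le _ (norm_nonneg f)).2 fun x => ?_
  have h1x : T.op t f x ≤ ‖f‖ := by simpa using h1' x
  have h2x : -‖f‖ ≤ T.op t f x := by simpa using h2' x
  exact abs_le.2 ⟨h2x, h1x⟩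

lemma dist_op_le (f : C(unitInterval, ℝ)) (s t : ℝ≥0) :
    dist (T.op s f) (T.op t f) ≤ ‖T.op (nndist s t) f - f‖ := by
  wlog h : s ≤ t generalizing s t
  · rw [dist_comm, nndist_comm]
    exact this t s (le_of_not_ge h)
  obtain ⟨r, rfl⟩ := exists_add_of_le h
  have hr : nndist s (s + r) = r := by
    ext; simp [NNReal.dist_eq]
  rw [hr, dist_comm, dist_eq_norm, T.op_add, ContinuousLinearMap.comp_apply, ← map_sub]
  exact T.norm_op_le s _

lemma continuous_op (f : C(unitInterval, ℝ)) : Continuous fun t => T.op t f := by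
  refine continuous_iff_continuousAt.2 fun t => tendsto_iff_dist_tendsto_zero.2 ?_
  refine squeeze_zero (fun _ => dist_nonneg) (fun s => T.dist_op_le f s t) ?_
  have h1 : Tendsto (fun s : ℝ≥0 => nndist s t) (𝓝 t) (𝓝 0) := by
    have : Continuous fun s : ℝ≥0 => nndist s t := by fun_prop
    simpa using this.tendsto t
  have h2 := ((T.continuous_zero f).comp h1).sub_const f |>.norm
  simpa using h2

lemma continuous_op_toNNReal (f : C(unitInterval, ℝ)) :
    Continuous fun r : ℝ => T.op r.toNNReal f :=
  (T.continuous_op f).comp continuous_real_toNNReal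

variable {T}

lemma Generator.op {f g : C(unitInterval, ℝ)} (h : T.Generator f g) (t : ℝ≥0) :
    T.Generator (T.op t f) (T.op t g) := by
  have := ((T.op t).continuous.tendsto g).comp h
  refine this.congr fun r => ?_
  simp only [Function.comp_apply, map_smul, map_sub]
  rw [← ContinuousLinearMap.comp_apply, ← ContinuousLinearMap.comp_apply, ← T.op_add,
    ← T.op_add, add_comm]

lemma Generator.sub {f g f' g' : C(unitInterval, ℝ)} (h : T.Generator f g)
    (h' : T.Generator f' g') : T.Generator (f - f') (g - g') := by
  refine (Tendsto.sub h h').congr fun r => ?_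
  rw [map_sub, ← smul_sub]
  congr 1
  abel

lemma Generator.smul {f g : C(unitInterval, ℝ)} (h : T.Generator f g) (c : ℝ) :
    T.Generator (c • f) (c • g) := by
  refine (Tendsto.const_smul h c).congr fun r => ?_
  rw [map_smul, ← smul_sub, smul_comm]

lemma tendsto_toNNReal_sub (x : ℝ) :
    Tendsto (fun y : ℝ => (y - x).toNNReal) (𝓝[>] x) (𝓝[>] 0) := by
  refine tendsto_nhdsWithin_iff.2 ⟨?_, ?_⟩
  · have : Continuous fun y : ℝ => (y - x).toNNReal := by fun_prop
    have h := this.tendsto x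
    simp only [sub_self, Real.toNNReal_zero] at h
    exact h.mono_left nhdsWithin_le_nhds
  · filter_upwards [self_mem_nhdsWithin] with y hy
    simpa using hy

/-- The definition of the generator controls right difference quotients only. One-sided derivatives
suffice below, since a continuous function with zero right derivative is constant. -/
lemma Generator.hasDerivWithinAt {f g : C(unitInterval, ℝ)} (h : T.Generator f g) {x : ℝ}
    (hx : 0 ≤ x) :
    HasDerivWithinAt (fun r : ℝ => T.op r.toNNReal f) (T.op x.toNNReal g) (Ici x) x := by
  rw [hasDerivWithinAt_iff_tendsto_slope, Ici_sdiff_left]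
  refine ((h.op x.toNNReal).comp (tendsto_toNNReal_sub x)).congr' ?_
  filter_upwards [self_mem_nhdsWithin] with y hy
  have hy' : x < y := hy
  have e : y.toNNReal = (y - x).toNNReal + x.toNNReal := by
    rw [← Real.toNNReal_add (by linarith) hx]; simp
  simp only [Function.comp_apply, slope, vsub_eq_sub]
  rw [Real.coe_toNNReal _ (by linarith), e, T.op_add, ContinuousLinearMap.comp_apply]

/-- Dynkin's formula. It converts a bound on a solution of A f = g into a bound on the time integral
of `T_r g`. -/
lemma Generator.op_sub_eq_integral {f g : C(unitInterval, ℝ)} (h : T.Generator f g) {t : ℝ}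
    (ht : 0 ≤ t) :
    T.op t.toNNReal f - f = ∫ r in (0 : ℝ)..t, T.op r.toNNReal g := by
  have hc := T.continuous_op_toNNReal g
  have key := constant_of_has_deriv_right_zero (a := 0) (b := t)
    (f := fun r : ℝ => T.op r.toNNReal f - ∫ r in (0 : ℝ)..r, T.op r.toNNReal g)
    (((T.continuous_op_toNNReal f).sub
      (intervalIntegral.continuous_primitive (fun _ _ => hc.intervalIntegrable _ _) 0)).continuousOn)
    (fun x hx => by
      have h1 := h.hasDerivWithinAt hx.1
      have h2 := (intervalIntegral.integral_hasDerivAt_right (hc.intervalIntegrable 0 x)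
        (hc.stronglyMeasurableAtFilter _ _) hc.continuousAt).hasDerivWithinAt (s := Ici x)
      have h3 := h1.sub h2
      rw [sub_self] at h3
      exact h3) t ⟨ht, le_rfl⟩
  simp only [Real.toNNReal_zero, T.op_zero, ContinuousLinearMap.id_apply,
    intervalIntegral.integral_same, sub_zero] at key
  rw [sub_eq_iff_eq_add'.1 key]; abel

variable (T)

/-- With Φ(x) = ∫₀ˣ T_r f dr, the semigroup property gives T_h Φ(t) = Φ(t+h) - Φ(h), so the
difference quotient is the slope at 0 of an explicit differentiable function. -/
lemma generator_integral (f : C(unitInterval, ℝ)) {t : ℝ} (ht : 0 ≤ t) :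
    T.Generator (∫ r in (0 : ℝ)..t, T.op r.toNNReal f) (T.op t.toNNReal f - f) := by
  have hc := T.continuous_op_toNNReal f
  have hi : ∀ x y, IntervalIntegrable (fun r : ℝ => T.op r.toNNReal f) volume x y :=
    fun x y => hc.intervalIntegrable x y
  set Φ : ℝ → C(unitInterval, ℝ) := fun x => ∫ r in (0 : ℝ)..x, T.op r.toNNReal f with hΦ
  have hd : ∀ x, HasDerivAt Φ (T.op x.toNNReal f) x := fun x =>
    intervalIntegral.integral_hasDerivAt_right (hi 0 x) (hc.stronglyMeasurableAtFilter _ _)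
      hc.continuousAt
  have h1 : HasDerivAt (fun h : ℝ => Φ (h + t) - Φ h) (T.op t.toNNReal f - f) 0 := by
    have h2 : HasDerivAt (fun h : ℝ => Φ (h + t)) (T.op t.toNNReal f) 0 := by
      simpa using (hd (0 + t)).comp_add_const 0 t
    have h3 : HasDerivAt Φ f 0 := by simpa [T.op_zero] using hd 0
    exact h2.sub h3
  have h4 := h1.hasDerivWithinAt (s := Ici 0)
  rw [hasDerivWithinAt_iff_tendsto_slope, Ici_sdiff_left] at h4
  have h5 : Tendsto (fun r : ℝ≥0 => (r : ℝ)) (𝓝[>] 0) (𝓝[>] 0) :=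
    tendsto_nhdsWithin_iff.2 ⟨(NNReal.continuous_coe.tendsto' 0 0 rfl).mono_left
      nhdsWithin_le_nhds, by
        filter_upwards [self_mem_nhdsWithin] with r hr
        simpa using hr⟩
  refine (h4.comp h5).congr fun h => ?_
  simp only [Function.comp_apply, slope, vsub_eq_sub, sub_zero, zero_add]
  congr 1
  have e1 : T.op h (Φ t) = Φ (h + t) - Φ h := by
    simp only [hΦ]
    rw [← ContinuousLinearMap.intervalIntegral_comp_comm _ (hi 0 t),
      intervalIntegral.integral_interval_sub_left (hi _ _) (hi _ _)]
    have e2 : ∫ r in (h : ℝ)..h + t, T.op r.toNNReal f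
        = ∫ r in (0 : ℝ)..t, T.op (r + h).toNNReal f := by
      rw [intervalIntegral.integral_comp_add_right (fun r => T.op r.toNNReal f), zero_add,
        add_comm t]
    rw [e2]
    refine intervalIntegral.integral_congr fun r hr => ?_
    rw [uIcc_of_le ht] at hr
    rw [Real.toNNReal_add hr.1 h.coe_nonneg, Real.toNNReal_coe, add_comm, T.op_add,
      ContinuousLinearMap.comp_apply]
  have e3 : Φ 0 = 0 := by simp [hΦ]
  rw [e1, e3, sub_zero]

lemma exists_generator_norm_sub_lt (f : C(unitInterval, ℝ)) {ε : ℝ} (hε : 0 < ε) :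
    ∃ f' g', T.Generator f' g' ∧ ‖f' - f‖ < ε := by
  have hc := T.continuous_op_toNNReal f
  have hd : HasDerivAt (fun x : ℝ => ∫ r in (0 : ℝ)..x, T.op r.toNNReal f) f 0 := by
    simpa [T.op_zero] using intervalIntegral.integral_hasDerivAt_right
      (hc.intervalIntegrable 0 0) (hc.stronglyMeasurableAtFilter _ _) hc.continuousAt
  have h4 := hd.hasDerivWithinAt (s := Ici 0)
  rw [hasDerivWithinAt_iff_tendsto_slope, Ici_sdiff_left] at h4
  have h5 := (h4.sub_const f).norm.eventually_lt_const (u := ε) (by simpa)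
  obtain ⟨t, ht, ht0⟩ := (h5.and self_mem_nhdsWithin).exists
  refine ⟨_, _, (T.generator_integral f (le_of_lt ht0)).smul t⁻¹, ?_⟩
  simpa [slope] using ht

lemma dense_domain : Dense {f | ∃ g, T.Generator f g} := by
  refine Metric.dense_iff.2 fun f ε hε => ?_
  obtain ⟨f', g', h, hlt⟩ := T.exists_generator_norm_sub_lt f hε
  exact ⟨f', by simpa [dist_eq_norm] using hlt, g', h⟩

/-- The orbits of two semigroups whose generators are intertwined by `L` are intertwined. -/
lemma intertwining {T T' : FellerSemigroup}
    (L : C(unitInterval, ℝ) →L[ℝ] C(unitInterval, ℝ))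
    (hL : ∀ f g, T.Generator f g → T'.Generator (L f) (L g)) (t : ℝ≥0)
    (f : C(unitInterval, ℝ)) : T'.op t (L f) = L (T.op t f) := by
  have hcl : IsClosed {f | T'.op t (L f) = L (T.op t f)} :=
    isClosed_eq (by fun_prop) (by fun_prop)
  refine (hcl.closure_subset_iff.2 ?_) (T.dense_domain f)
  rintro f ⟨g, hfg⟩
  -- For f in the domain, the path s ↦ T'_{t-s} L T_s f interpolates between the two sides. It is
  -- shown to be continuous with zero right derivative.
  have hcont : Continuous fun s : ℝ => T'.op (t - s).toNNReal (L (T.op s.toNNReal f)) := by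
    have h1 : Continuous fun s : ℝ => L (T.op s.toNNReal f) :=
      L.continuous.comp (T.continuous_op_toNNReal f)
    refine continuous_iff_continuousAt.2 fun s₀ => ?_
    have h2 : Tendsto (fun s : ℝ => T'.op (t - s).toNNReal (L (T.op s₀.toNNReal f))) (𝓝 s₀)
        (𝓝 (T'.op (t - s₀).toNNReal (L (T.op s₀.toNNReal f)))) :=
      ((T'.continuous_op_toNNReal (L (T.op s₀.toNNReal f))).comp
        (continuous_const.sub continuous_id)).tendsto s₀
    have h3 : Tendsto (fun s : ℝ => T'.op (t - s).toNNReal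
        (L (T.op s.toNNReal f) - L (T.op s₀.toNNReal f))) (𝓝 s₀) (𝓝 0) := by
      refine squeeze_zero_norm (fun s => T'.norm_op_le _ _) ?_
      simpa using ((h1.tendsto s₀).sub_const (L (T.op s₀.toNNReal f))).norm
    have h4 := h3.add h2
    simpa [ContinuousAt, map_sub] using h4
  have key := constant_of_has_deriv_right_zero (a := 0) (b := t) hcont.continuousOn
    (fun s hs => by
      rw [hasDerivWithinAt_iff_tendsto_slope, Ici_sdiff_left]
      have hgen := hfg.op s.toNNReal
      have h1 := Tendsto.sub ((L.continuous.tendsto _).comp hgen) (hL _ _ hgen)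
      rw [sub_self] at h1
      have h2 := (h1.comp (tendsto_toNNReal_sub s)).norm
      rw [norm_zero] at h2
      -- For y > s the factor T'_{t-y} comes out of the difference of values at y and s. Being a
      -- contraction, it leaves the difference between L of a quotient of T and the corresponding
      -- quotient of T'; both tend to L T_s g.
      refine squeeze_zero_norm' ?_ h2
      filter_upwards [Ioo_mem_nhdsGT hs.2] with y hy
      have e1 : (t - s : ℝ).toNNReal = (t - y : ℝ).toNNReal + (y - s).toNNReal := by
        rw [← Real.toNNReal_add (by linarith [hy.2]) (by linarith [hy.1])]; simp
      have e2 : y.toNNReal = (y - s).toNNReal + s.toNNReal := by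
        rw [← Real.toNNReal_add (by linarith [hy.1]) hs.1]; simp
      simp only [Function.comp_apply, slope, vsub_eq_sub]
      rw [e1, e2, T.op_add, T'.op_add, ContinuousLinearMap.comp_apply,
        ContinuousLinearMap.comp_apply, ← map_sub, ← map_smul]
      refine (T'.norm_op_le _ _).trans (le_of_eq ?_)
      rw [Real.coe_toNNReal _ (by linarith [hy.1] : 0 ≤ y - s), map_smul, ← smul_sub, map_sub]
      congr 2
      abel) t ⟨t.2, le_rfl⟩
  simpa [T.op_zero, T'.op_zero] using key.symm

end FellerSemigroup

/-! ### Scale, speed and the Green potential -/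

lemma uIcc_half_subset {x : ℝ} (hx : x ∈ Ioo (0 : ℝ) 1) : uIcc (1 / 2 : ℝ) x ⊆ Ioo (0 : ℝ) 1 :=
  ordConnected_Ioo.uIcc_subset (by norm_num) hx

/-- The fundamental theorem of calculus for a function continuous on an open set. -/
lemma hasDerivAt_integral_of_continuousOn {u : ℝ → ℝ} {U : Set ℝ} (hU : IsOpen U)
    (hu : ContinuousOn u U) {c x : ℝ} (hx : x ∈ U) (hi : IntervalIntegrable u volume c x) :
    HasDerivAt (fun z => ∫ y in c..z, u y) (u x) x :=
  intervalIntegral.integral_hasDerivAt_right hi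
    (hu.stronglyMeasurableAtFilter hU x hx) (hu.continuousAt (hU.mem_nhds hx))

lemma ofReal_intervalIntegral {u : ℝ → ℝ} {c d : ℝ} (hcd : c ≤ d)
    (hi : IntervalIntegrable u volume c d) (h0 : ∀ y ∈ Ioo c d, 0 ≤ u y) :
    ENNReal.ofReal (∫ y in c..d, u y) = ∫⁻ y in Ioo c d, ENNReal.ofReal (u y) := by
  rw [intervalIntegral.integral_of_le hcd, integral_Ioc_eq_integral_Ioo]
  exact ofReal_integral_eq_lintegral_ofReal
    ((intervalIntegrable_iff_integrableOn_Ioo_of_le hcd).1 hi)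
    (ae_restrict_of_forall_mem measurableSet_Ioo h0)

/-- Tonelli's theorem over the triangle `η < y`. -/
lemma lintegral_triangle (μ : Measure ℝ) [SFinite μ] {u v : ℝ → ℝ≥0∞} (hu : AEMeasurable u μ)
    (hv : AEMeasurable v μ) :
    ∫⁻ η, (∫⁻ y in Ioi η, u y ∂μ) * v η ∂μ = ∫⁻ y, u y * ∫⁻ η in Iio y, v η ∂μ ∂μ := by
  have hm : MeasurableSet {p : ℝ × ℝ | p.1 < p.2} := measurableSet_lt measurable_fst measurable_snd
  have h1 : AEMeasurable (Function.uncurry fun η y : ℝ =>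
      {p : ℝ × ℝ | p.1 < p.2}.indicator (fun p => u p.2 * v p.1) (η, y)) (μ.prod μ) :=
    AEMeasurable.indicator (hu.comp_snd.mul hv.comp_fst) hm
  have h2 := lintegral_lintegral_swap h1
  convert h2 using 2
  · ext η
    rw [← lintegral_mul_const'' _ hu.restrict, ← lintegral_indicator measurableSet_Ioi]
    rfl
  · ext y
    rw [← lintegral_const_mul'' _ hv.restrict, ← lintegral_indicator measurableSet_Iio]
    rfl

lemma scaleDensity_pos (a b : ℝ → ℝ) (x : ℝ) : 0 < scaleDensity a b x := Real.exp_pos _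

section Diffusion

variable {a b : ℝ → ℝ} {T : FellerSemigroup} (hT : IsReflectingOrEntrance a b T)
include hT

namespace IsReflectingOrEntrance

lemma bdryN0_lt_top : bdryN0 a b < ∞ := hT.boundary_zero.elim (·.1) (·.1)

lemma bdryN1_lt_top : bdryN1 a b < ∞ := hT.boundary_one.elim (·.1) (·.1)

lemma hasDerivAt_scaleDensity {x : ℝ} (hx : x ∈ Ioo (0 : ℝ) 1) :
    HasDerivAt (scaleDensity a b) (scaleDensity a b x * -(2 * a x / b x)) x := by
  have hq : ContinuousOn (fun y => 2 * a y / b y) (Ioo (0 : ℝ) 1) :=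
    (continuousOn_const.mul hT.drift_continuousOn).div hT.variance_continuousOn
      fun y hy => (hT.variance_pos y hy).ne'
  exact (hasDerivAt_integral_of_continuousOn isOpen_Ioo hq hx
    (hq.mono (uIcc_half_subset hx)).intervalIntegrable).neg.exp

lemma continuousOn_scaleDensity : ContinuousOn (scaleDensity a b) (Ioo (0 : ℝ) 1) :=
  fun _ hx => (hT.hasDerivAt_scaleDensity hx).continuousAt.continuousWithinAt

lemma speedDensity_pos {x : ℝ} (hx : x ∈ Ioo (0 : ℝ) 1) : 0 < speedDensity a b x :=
  inv_pos.2 (mul_pos (scaleDensity_pos a b x) (hT.variance_pos x hx))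

lemma continuousOn_speedDensity : ContinuousOn (speedDensity a b) (Ioo (0 : ℝ) 1) :=
  (hT.continuousOn_scaleDensity.mul hT.variance_continuousOn).inv₀
    fun x hx => (mul_pos (scaleDensity_pos a b x) (hT.variance_pos x hx)).ne'

lemma intervalIntegrable_scaleDensity {c d : ℝ} (hc : c ∈ Ioo (0 : ℝ) 1)
    (hd : d ∈ Ioo (0 : ℝ) 1) : IntervalIntegrable (scaleDensity a b) volume c d :=
  (hT.continuousOn_scaleDensity.mono (ordConnected_Ioo.uIcc_subset hc hd)).intervalIntegrable

lemma scaleFn_sub {c d : ℝ} (hc : c ∈ Ioo (0 : ℝ) 1) (hd : d ∈ Ioo (0 : ℝ) 1) :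
    scaleFn a b d - scaleFn a b c = ∫ y in c..d, scaleDensity a b y := by
  have h : (1 / 2 : ℝ) ∈ Ioo (0 : ℝ) 1 := by norm_num
  exact intervalIntegral.integral_interval_sub_left
    (hT.intervalIntegrable_scaleDensity h hd) (hT.intervalIntegrable_scaleDensity h hc)

lemma scaleFn_lt {c d : ℝ} (hc : c ∈ Ioo (0 : ℝ) 1) (hd : d ∈ Ioo (0 : ℝ) 1) (hcd : c < d) :
    scaleFn a b c < scaleFn a b d := by
  rw [← sub_pos, hT.scaleFn_sub hc hd]
  exact intervalIntegral.intervalIntegral_pos_of_pos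
    (hT.intervalIntegrable_scaleDensity hc hd) (scaleDensity_pos a b) hcd

lemma aemeasurable_scaleDensity :
    AEMeasurable (fun y => ENNReal.ofReal (scaleDensity a b y))
      (volume.restrict (Ioo (0 : ℝ) 1)) :=
  (hT.continuousOn_scaleDensity.aemeasurable measurableSet_Ioo).ennreal_ofReal

lemma aemeasurable_speedDensity :
    AEMeasurable (fun y => ENNReal.ofReal (speedDensity a b y))
      (volume.restrict (Ioo (0 : ℝ) 1)) :=
  (hT.continuousOn_speedDensity.aemeasurable measurableSet_Ioo).ennreal_ofReal

/-- If a weight `w` bounded below by `c > 0` on `A` makes `w m` integrable on `A`, so is `m`. -/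
lemma integrableOn_speedDensity_of_weight {A : Set ℝ} (hA : MeasurableSet A)
    (hA' : A ⊆ Ioo (0 : ℝ) 1) {w : ℝ → ℝ} {c : ℝ} (hc : 0 < c) (hw : ∀ y ∈ A, c ≤ w y)
    (hfin : ∫⁻ y in A, ENNReal.ofReal (w y * speedDensity a b y) < ∞) :
    IntegrableOn (speedDensity a b) A := by
  have hm : AEStronglyMeasurable (speedDensity a b) (volume.restrict A) :=
    (hT.continuousOn_speedDensity.mono hA').aestronglyMeasurable hA
  have h : ∫⁻ y in A, ENNReal.ofReal c⁻¹ * ENNReal.ofReal (w y * speedDensity a b y) < ∞ := by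
    rw [lintegral_const_mul' _ _ ENNReal.ofReal_ne_top]
    exact ENNReal.mul_lt_top ENNReal.ofReal_lt_top hfin
  refine ⟨hm, (lintegral_mono_ae ?_).trans_lt h⟩
  refine ae_restrict_of_forall_mem hA fun y hy => ?_
  have hp := hT.speedDensity_pos (hA' hy)
  rw [Real.enorm_of_nonneg hp.le, ← ENNReal.ofReal_mul (inv_nonneg.2 hc.le)]
  refine ENNReal.ofReal_le_ofReal ?_
  rw [← mul_assoc]
  refine le_mul_of_one_le_left hp.le ?_
  rw [inv_mul_eq_div, one_le_div hc]
  exact hw y hy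

/-- Near each end the scale increment weighting m in N(0) or N(1) is bounded below, so a finite N
forces finite speed mass. The points 1/4 and 3/4 only keep a distance from the base point, where the
weight vanishes. -/
lemma integrableOn_speedDensity : IntegrableOn (speedDensity a b) (Ioo (0 : ℝ) 1) := by
  have hmid : IntegrableOn (speedDensity a b) (Icc (1 / 4 : ℝ) (3 / 4)) :=
    (hT.continuousOn_speedDensity.mono
      fun x hx => ⟨by linarith [hx.1], by linarith [hx.2]⟩).integrableOn_Icc
  have hleft : IntegrableOn (speedDensity a b) (Ioc (0 : ℝ) (1 / 4)) := by
    refine hT.integrableOn_speedDensity_of_weight measurableSet_Ioc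
      (fun x hx => ⟨hx.1, by linarith [hx.2]⟩)
      (w := fun y => scaleFn a b (1 / 2) - scaleFn a b y)
      (sub_pos.2 (hT.scaleFn_lt (c := 1 / 4) (d := 1 / 2) (by norm_num) (by norm_num)
        (by norm_num))) (fun y hy => ?_)
      ((lintegral_mono_set (Ioc_subset_Ioc_right (by norm_num))).trans_lt hT.bdryN0_lt_top)
    refine sub_le_sub_left ?_ _
    rcases hy.2.eq_or_lt with h | h
    · rw [h]
    · exact (hT.scaleFn_lt ⟨hy.1, by linarith⟩ (by norm_num) h).le
  have hright : IntegrableOn (speedDensity a b) (Ico (3 / 4 : ℝ) 1) := by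
    refine hT.integrableOn_speedDensity_of_weight measurableSet_Ico
      (fun x hx => ⟨by linarith [hx.1], hx.2⟩)
      (w := fun y => scaleFn a b y - scaleFn a b (1 / 2))
      (sub_pos.2 (hT.scaleFn_lt (c := 1 / 2) (d := 3 / 4) (by norm_num) (by norm_num)
        (by norm_num))) (fun y hy => ?_)
      ((lintegral_mono_set (Ico_subset_Ico_left (by norm_num))).trans_lt hT.bdryN1_lt_top)
    refine sub_le_sub_right ?_ _
    rcases hy.1.eq_or_lt with h | h
    · rw [h]
    · exact (hT.scaleFn_lt (by norm_num) ⟨by linarith, hy.2⟩ h).le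
  refine ((hleft.union hmid).union hright).mono_set fun x hx => ?_
  rcases le_or_gt x (1 / 4) with h | h
  · exact Or.inl (Or.inl ⟨hx.1, h⟩)
  rcases le_or_gt x (3 / 4) with h' | h'
  · exact Or.inl (Or.inr ⟨h.le, h'⟩)
  · exact Or.inr ⟨h'.le, hx.2⟩

lemma intervalIntegrable_speedDensity {c d : ℝ} (hc : c ∈ Icc (0 : ℝ) 1)
    (hd : d ∈ Icc (0 : ℝ) 1) : IntervalIntegrable (speedDensity a b) volume c d := by
  have h := (intervalIntegrable_iff_integrableOn_Ioo_of_le zero_le_one).2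
    hT.integrableOn_speedDensity
  refine h.mono_set ?_
  rw [uIcc_of_le zero_le_one]
  exact ordConnected_Icc.uIcc_subset hc hd

lemma continuousOn_integral_speedDensity {c : ℝ} (hc : c ∈ Icc (0 : ℝ) 1) :
    ContinuousOn (fun x => ∫ y in c..x, speedDensity a b y) (Icc (0 : ℝ) 1) := by
  have h := intervalIntegral.continuousOn_primitive_interval'
    (hT.intervalIntegrable_speedDensity (left_mem_Icc.2 zero_le_one)
      (right_mem_Icc.2 zero_le_one)) (a := c) (by rwa [uIcc_of_le zero_le_one])
  rwa [uIcc_of_le zero_le_one] at h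

/-- Tonelli: N(0) is the integral of s(y) m(η) over η < y ≤ 1/2, and integrating in η first leaves
s(y) times the speed mass of (0,y). -/
lemma integrableOn_scale_mul_left :
    IntegrableOn (fun y => scaleDensity a b y * ∫ η in (0 : ℝ)..y, speedDensity a b η)
      (Ioc 0 (1 / 2)) := by
  have hsub : Ioc (0 : ℝ) (1 / 2) ⊆ Ioo 0 1 := fun x hx => ⟨hx.1, by linarith [hx.2]⟩
  have hcont := (hT.continuousOn_scaleDensity.mul
    ((hT.continuousOn_integral_speedDensity (left_mem_Icc.2 zero_le_one)).mono
      Ioo_subset_Icc_self)).mono hsub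
  refine ⟨hcont.aestronglyMeasurable measurableSet_Ioc, ?_⟩
  have hμ : volume.restrict (Ioc (0 : ℝ) (1 / 2)) ≤ volume.restrict (Ioo (0 : ℝ) 1) :=
    Measure.restrict_mono hsub le_rfl
  have key := lintegral_triangle (volume.restrict (Ioc (0 : ℝ) (1 / 2)))
    (hT.aemeasurable_scaleDensity.mono_measure hμ) (hT.aemeasurable_speedDensity.mono_measure hμ)
  have e1 : ∫⁻ η in Ioc (0 : ℝ) (1 / 2), (∫⁻ y in Ioi η, ENNReal.ofReal (scaleDensity a b y)
      ∂(volume.restrict (Ioc (0 : ℝ) (1 / 2)))) * ENNReal.ofReal (speedDensity a b η)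
      = bdryN0 a b := by
    refine setLIntegral_congr_fun measurableSet_Ioc fun η hη => ?_
    have hs := hT.scaleFn_sub (hsub hη) (d := 1 / 2) (by norm_num)
    rw [Measure.restrict_restrict measurableSet_Ioi, hs, ENNReal.ofReal_mul
      (intervalIntegral.integral_nonneg hη.2 fun y _ => (scaleDensity_pos a b y).le),
      ofReal_intervalIntegral hη.2 (hT.intervalIntegrable_scaleDensity (hsub hη) (by norm_num))
        fun y _ => (scaleDensity_pos a b y).le]
    congr 2
    rw [inter_comm, Ioc_inter_Ioi, sup_of_le_right hη.1.le]
    exact Measure.restrict_congr_set Ioo_ae_eq_Ioc.symm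
  rw [e1] at key
  refine lt_of_eq_of_lt ?_ hT.bdryN0_lt_top
  rw [key]
  refine setLIntegral_congr_fun measurableSet_Ioc fun y hy => ?_
  have hpos : ∀ η ∈ Ioo 0 y, 0 ≤ speedDensity a b η := fun η hη =>
    (hT.speedDensity_pos ⟨hη.1, hη.2.trans (hsub hy).2⟩).le
  have hi := hT.intervalIntegrable_speedDensity (left_mem_Icc.2 zero_le_one)
    (Ioo_subset_Icc_self (hsub hy))
  rw [Real.enorm_eq_ofReal_abs, abs_mul, ENNReal.ofReal_mul (abs_nonneg _),
    abs_of_pos (scaleDensity_pos a b y), abs_of_nonneg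
      (intervalIntegral.integral_nonneg_of_ae_restrict hy.1.le ?_),
    ofReal_intervalIntegral hy.1.le hi hpos, Measure.restrict_restrict measurableSet_Iio]
  · congr 3
    ext z; simp only [mem_Ioo, mem_inter_iff, mem_Iio, mem_Ioc]
    constructor
    · exact fun h => ⟨h.2, h.1, h.2.le.trans hy.2⟩
    · exact fun h => ⟨h.2.1, h.1⟩
  · rw [Measure.restrict_congr_set Ioo_ae_eq_Icc.symm]
    exact ae_restrict_of_forall_mem measurableSet_Ioo hpos

/-- Mirror image of `integrableOn_scale_mul_left`, with N(1). -/
lemma integrableOn_scale_mul_right :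
    IntegrableOn (fun y => scaleDensity a b y * ∫ η in y..1, speedDensity a b η)
      (Ico (1 / 2) 1) := by
  have hsub : Ico (1 / 2 : ℝ) 1 ⊆ Ioo 0 1 := fun x hx => ⟨by linarith [hx.1], hx.2⟩
  have hcont : ContinuousOn
      (fun y => scaleDensity a b y * ∫ η in y..1, speedDensity a b η) (Ico (1 / 2 : ℝ) 1) := by
    refine ((hT.continuousOn_scaleDensity.mul
      ((hT.continuousOn_integral_speedDensity (right_mem_Icc.2 zero_le_one)).neg.mono
        Ioo_subset_Icc_self)).mono hsub).congr fun y _ => ?_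
    rw [intervalIntegral.integral_symm 1 y]
    rfl
  refine ⟨hcont.aestronglyMeasurable measurableSet_Ico, ?_⟩
  have hμ : volume.restrict (Ico (1 / 2 : ℝ) 1) ≤ volume.restrict (Ioo (0 : ℝ) 1) :=
    Measure.restrict_mono hsub le_rfl
  have key := lintegral_triangle (volume.restrict (Ico (1 / 2 : ℝ) 1))
    (hT.aemeasurable_speedDensity.mono_measure hμ) (hT.aemeasurable_scaleDensity.mono_measure hμ)
  have e1 : ∫⁻ η in Ico (1 / 2 : ℝ) 1, ENNReal.ofReal (speedDensity a b η) *
      (∫⁻ y in Iio η, ENNReal.ofReal (scaleDensity a b y)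
      ∂(volume.restrict (Ico (1 / 2 : ℝ) 1))) = bdryN1 a b := by
    refine setLIntegral_congr_fun measurableSet_Ico fun η hη => ?_
    have hs := hT.scaleFn_sub (c := 1 / 2) (by norm_num) (hsub hη)
    rw [Measure.restrict_restrict measurableSet_Iio, hs, ENNReal.ofReal_mul
      (intervalIntegral.integral_nonneg hη.1 fun y _ => (scaleDensity_pos a b y).le),
      ofReal_intervalIntegral hη.1 (hT.intervalIntegrable_scaleDensity (by norm_num) (hsub hη))
        fun y _ => (scaleDensity_pos a b y).le, mul_comm]
    congr 2
    rw [inter_comm, Ico_inter_Iio, inf_of_le_right hη.2.le]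
    exact Measure.restrict_congr_set Ioo_ae_eq_Ico.symm
  rw [e1] at key
  refine lt_of_eq_of_lt ?_ hT.bdryN1_lt_top
  rw [← key]
  refine setLIntegral_congr_fun measurableSet_Ico fun y hy => ?_
  have hpos : ∀ η ∈ Ioo y 1, 0 ≤ speedDensity a b η := fun η hη =>
    (hT.speedDensity_pos ⟨(hsub hy).1.trans hη.1, hη.2⟩).le
  have hi := hT.intervalIntegrable_speedDensity (Ioo_subset_Icc_self (hsub hy))
    (right_mem_Icc.2 zero_le_one)
  rw [Real.enorm_eq_ofReal_abs, abs_mul, ENNReal.ofReal_mul (abs_nonneg _),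
    abs_of_pos (scaleDensity_pos a b y), abs_of_nonneg
      (intervalIntegral.integral_nonneg_of_ae_restrict hy.2.le ?_),
    ofReal_intervalIntegral hy.2.le hi hpos, Measure.restrict_restrict measurableSet_Ioi, mul_comm]
  · congr 3
    ext z; simp only [mem_Ioo, mem_inter_iff, mem_Ioi, mem_Ico]
    constructor
    · exact fun h => ⟨h.1, hy.1.trans h.1.le, h.2⟩
    · exact fun h => ⟨h.1, h.2.2⟩
  · rw [Measure.restrict_congr_set Ioo_ae_eq_Icc.symm]
    exact ae_restrict_of_forall_mem measurableSet_Ioo hpos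

end IsReflectingOrEntrance
end Diffusion

/-! ### The equation A f = h for a centred source -/

/-- The flux `∫₀ˣ h dM` of a source `h`. -/
noncomputable def flux (a b : ℝ → ℝ) (h : C(unitInterval, ℝ)) (x : ℝ) : ℝ :=
  ∫ y in (0 : ℝ)..x, IccExtend zero_le_one h y * speedDensity a b y

/-- The potential `2 ∫ flux dS`, which solves `A f = h` on `(0,1)`. -/
noncomputable def potential (a b : ℝ → ℝ) (h : C(unitInterval, ℝ)) (x : ℝ) : ℝ :=
  ∫ y in (1 / 2 : ℝ)..x, 2 * (scaleDensity a b y * flux a b h y)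

/-- The speed mass between `x` and the boundary point nearest to it. -/
noncomputable def tailSpeed (a b : ℝ → ℝ) (x : ℝ) : ℝ :=
  if x ≤ 1 / 2 then ∫ y in (0 : ℝ)..x, speedDensity a b y else ∫ y in x..1, speedDensity a b y

lemma continuous_IccExtend (h : C(unitInterval, ℝ)) : Continuous (IccExtend zero_le_one h) :=
  h.continuous.Icc_extend'

lemma abs_IccExtend_le (h : C(unitInterval, ℝ)) (x : ℝ) : |IccExtend zero_le_one h x| ≤ ‖h‖ :=
  h.norm_coe_le_norm _

section Diffusion

variable {a b : ℝ → ℝ} {T : FellerSemigroup} (hT : IsReflectingOrEntrance a b T)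
include hT

namespace IsReflectingOrEntrance

lemma continuousOn_source (h : C(unitInterval, ℝ)) :
    ContinuousOn (fun y => IccExtend zero_le_one h y * speedDensity a b y) (Ioo (0 : ℝ) 1) :=
  (continuous_IccExtend h).continuousOn.mul hT.continuousOn_speedDensity

lemma intervalIntegrable_source (h : C(unitInterval, ℝ)) {c d : ℝ} (hc : c ∈ Icc (0 : ℝ) 1)
    (hd : d ∈ Icc (0 : ℝ) 1) :
    IntervalIntegrable (fun y => IccExtend zero_le_one h y * speedDensity a b y) volume c d :=
  (hT.intervalIntegrable_speedDensity hc hd).continuousOn_mul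
    (continuous_IccExtend h).continuousOn

lemma continuousOn_flux (h : C(unitInterval, ℝ)) :
    ContinuousOn (flux a b h) (Icc (0 : ℝ) 1) := by
  have h0 := intervalIntegral.continuousOn_primitive_interval'
    (hT.intervalIntegrable_source h (left_mem_Icc.2 zero_le_one)
      (right_mem_Icc.2 zero_le_one)) (a := 0) left_mem_uIcc
  rwa [uIcc_of_le zero_le_one] at h0

lemma hasDerivAt_flux (h : C(unitInterval, ℝ)) {x : ℝ} (hx : x ∈ Ioo (0 : ℝ) 1) :
    HasDerivAt (flux a b h) (IccExtend zero_le_one h x * speedDensity a b x) x :=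
  hasDerivAt_integral_of_continuousOn isOpen_Ioo (hT.continuousOn_source h) hx
    (hT.intervalIntegrable_source h (left_mem_Icc.2 zero_le_one) (Ioo_subset_Icc_self hx))

lemma abs_integral_source_le (h : C(unitInterval, ℝ)) {c d : ℝ} (hc : c ∈ Icc (0 : ℝ) 1)
    (hd : d ∈ Icc (0 : ℝ) 1) (hcd : c ≤ d) :
    |∫ y in c..d, IccExtend zero_le_one h y * speedDensity a b y|
      ≤ ∫ y in c..d, |IccExtend zero_le_one h y| * speedDensity a b y := by
  rw [← Real.norm_eq_abs]
  refine (intervalIntegral.norm_integral_le_integral_norm hcd).trans (le_of_eq ?_)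
  rw [intervalIntegral.integral_of_le hcd, intervalIntegral.integral_of_le hcd,
    integral_Ioc_eq_integral_Ioo, integral_Ioc_eq_integral_Ioo]
  refine setIntegral_congr_fun measurableSet_Ioo fun y hy => ?_
  simp only [Real.norm_eq_abs]
  rw [abs_mul, abs_of_pos (hT.speedDensity_pos ⟨hc.1.trans_lt hy.1, hy.2.trans_le hd.2⟩)]

lemma integral_abs_source_le (h : C(unitInterval, ℝ)) {c d : ℝ} (hc : c ∈ Icc (0 : ℝ) 1)
    (hd : d ∈ Icc (0 : ℝ) 1) (hcd : c ≤ d) :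
    ∫ y in c..d, |IccExtend zero_le_one h y| * speedDensity a b y
      ≤ ‖h‖ * ∫ y in c..d, speedDensity a b y := by
  rw [← intervalIntegral.integral_const_mul]
  refine intervalIntegral.integral_mono_on_of_le_Ioo hcd
    ((hT.intervalIntegrable_speedDensity hc hd).continuousOn_mul
      (continuous_IccExtend h).abs.continuousOn)
    ((hT.intervalIntegrable_speedDensity hc hd).const_mul _) fun y hy => ?_
  exact mul_le_mul_of_nonneg_right (abs_IccExtend_le h y)
    (hT.speedDensity_pos ⟨hc.1.trans_lt hy.1, hy.2.trans_le hd.2⟩).le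

lemma abs_flux_le (h : C(unitInterval, ℝ)) {x : ℝ} (hx : x ∈ Icc (0 : ℝ) 1) :
    |flux a b h x| ≤ ∫ y in (0 : ℝ)..1, |IccExtend zero_le_one h y| * speedDensity a b y := by
  refine (hT.abs_integral_source_le h (left_mem_Icc.2 zero_le_one) hx hx.1).trans ?_
  have hi : ∀ {c d : ℝ}, c ∈ Icc (0 : ℝ) 1 → d ∈ Icc (0 : ℝ) 1 → IntervalIntegrable
      (fun y => |IccExtend zero_le_one h y| * speedDensity a b y) volume c d := fun hc hd =>
    (hT.intervalIntegrable_speedDensity hc hd).continuousOn_mul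
      (continuous_IccExtend h).abs.continuousOn
  rw [← intervalIntegral.integral_add_adjacent_intervals
    (hi (left_mem_Icc.2 zero_le_one) hx) (hi hx (right_mem_Icc.2 zero_le_one))]
  refine le_add_of_nonneg_right (intervalIntegral.integral_nonneg_of_ae_restrict hx.2 ?_)
  rw [Measure.restrict_congr_set Ioo_ae_eq_Icc.symm]
  exact ae_restrict_of_forall_mem measurableSet_Ioo fun y hy =>
    mul_nonneg (abs_nonneg _) (hT.speedDensity_pos ⟨hx.1.trans_lt hy.1, hy.2⟩).le

/-- Since the total flux is zero, the flux at x can be computed from either end; the nearer end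
gives the bound. This decay is essential at an entrance boundary, where s alone is not integrable.
-/
lemma abs_flux_le_tailSpeed {h : C(unitInterval, ℝ)} (h1 : flux a b h 1 = 0) {x : ℝ}
    (hx : x ∈ Ioo (0 : ℝ) 1) : |flux a b h x| ≤ ‖h‖ * tailSpeed a b x := by
  have hx' := Ioo_subset_Icc_self hx
  have h0 := left_mem_Icc.2 (zero_le_one (α := ℝ))
  have h1' := right_mem_Icc.2 (zero_le_one (α := ℝ))
  unfold tailSpeed
  split_ifs with hx2
  · exact (hT.abs_integral_source_le h h0 hx' hx'.1).trans (hT.integral_abs_source_le h h0 hx' hx'.1)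
  · have e : flux a b h x =
        -∫ y in x..1, IccExtend zero_le_one h y * speedDensity a b y := by
      exact eq_neg_iff_add_eq_zero.2 ((intervalIntegral.integral_add_adjacent_intervals
        (hT.intervalIntegrable_source h h0 hx') (hT.intervalIntegrable_source h hx' h1')).trans h1)
    rw [e, abs_neg]
    exact (hT.abs_integral_source_le h hx' h1' hx'.2).trans
      (hT.integral_abs_source_le h hx' h1' hx'.2)

lemma integrableOn_scale_mul_tailSpeed :
    IntegrableOn (fun y => scaleDensity a b y * tailSpeed a b y) (Ioo 0 1) := by
  have h1 : IntegrableOn (fun y => scaleDensity a b y * tailSpeed a b y) (Ioc 0 (1 / 2)) :=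
    hT.integrableOn_scale_mul_left.congr_fun
      (fun y hy => by simp only [tailSpeed, if_pos hy.2]) measurableSet_Ioc
  have h2 : IntegrableOn (fun y => scaleDensity a b y * tailSpeed a b y) (Ioo (1 / 2) 1) :=
    (hT.integrableOn_scale_mul_right.mono_set Ioo_subset_Ico_self).congr_fun
      (fun y hy => by simp only [tailSpeed, if_neg (not_le.2 hy.1)]) measurableSet_Ioo
  exact (h1.union h2).mono_set fun y hy =>
    (le_or_gt y (1 / 2)).elim (fun h => Or.inl ⟨hy.1, h⟩) fun h => Or.inr ⟨h, hy.2⟩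

lemma continuousOn_scale_mul_flux (h : C(unitInterval, ℝ)) :
    ContinuousOn (fun y => 2 * (scaleDensity a b y * flux a b h y)) (Ioo (0 : ℝ) 1) :=
  continuousOn_const.mul
    (hT.continuousOn_scaleDensity.mul ((hT.continuousOn_flux h).mono Ioo_subset_Icc_self))

lemma abs_scale_mul_flux_le {h : C(unitInterval, ℝ)} (h1 : flux a b h 1 = 0) {x : ℝ}
    (hx : x ∈ Ioo (0 : ℝ) 1) :
    |2 * (scaleDensity a b x * flux a b h x)|
      ≤ 2 * (‖h‖ * (scaleDensity a b x * tailSpeed a b x)) := by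
  rw [abs_mul, abs_mul, abs_two, abs_of_pos (scaleDensity_pos a b x), mul_left_comm ‖h‖]
  gcongr
  · exact (scaleDensity_pos a b x).le
  · exact hT.abs_flux_le_tailSpeed h1 hx

lemma intervalIntegrable_scale_mul_flux {h : C(unitInterval, ℝ)} (h1 : flux a b h 1 = 0) :
    IntervalIntegrable (fun y => 2 * (scaleDensity a b y * flux a b h y)) volume 0 1 := by
  rw [intervalIntegrable_iff_integrableOn_Ioo_of_le zero_le_one]
  refine ((hT.integrableOn_scale_mul_tailSpeed.const_mul ‖h‖).const_mul 2).mono'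
    ((hT.continuousOn_scale_mul_flux h).aestronglyMeasurable measurableSet_Ioo)
    (ae_restrict_of_forall_mem measurableSet_Ioo fun x hx => hT.abs_scale_mul_flux_le h1 hx)

lemma continuousOn_potential {h : C(unitInterval, ℝ)} (h1 : flux a b h 1 = 0) :
    ContinuousOn (potential a b h) (Icc (0 : ℝ) 1) := by
  have h0 := intervalIntegral.continuousOn_primitive_interval'
    (hT.intervalIntegrable_scale_mul_flux h1) (a := 1 / 2)
    (by rw [uIcc_of_le zero_le_one]; norm_num)
  rwa [uIcc_of_le zero_le_one] at h0

lemma hasDerivAt_potential {h : C(unitInterval, ℝ)} {x : ℝ} (hx : x ∈ Ioo (0 : ℝ) 1) :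
    HasDerivAt (potential a b h) (2 * (scaleDensity a b x * flux a b h x)) x :=
  hasDerivAt_integral_of_continuousOn isOpen_Ioo (hT.continuousOn_scale_mul_flux h) hx
    ((hT.continuousOn_scale_mul_flux h).mono (uIcc_half_subset hx)).intervalIntegrable

/-- Here f'/s = 2 · flux, whose derivative 2hm gives A f = h. The flux vanishes at 0 by construction
and at 1 by hypothesis, so the reflection condition holds at both ends. -/
lemma memGraph_potential {h f : C(unitInterval, ℝ)} (h1 : flux a b h 1 = 0)
    (hf : ∀ x, f x = potential a b h x) : MemGraph a b f h := by
  set p : ℝ → ℝ := fun y => 2 * (scaleDensity a b y * flux a b h y) with hp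
  have heq : ∀ x ∈ Ioo (0 : ℝ) 1, IccExtend zero_le_one f =ᶠ[𝓝 x] potential a b h := by
    intro x hx
    filter_upwards [isOpen_Ioo.mem_nhds hx] with y hy
    rw [IccExtend_of_mem zero_le_one f (Ioo_subset_Icc_self hy)]
    exact hf _
  have hd : ∀ x ∈ Ioo (0 : ℝ) 1, HasDerivAt (IccExtend zero_le_one f) (p x) x := fun x hx =>
    (hT.hasDerivAt_potential hx).congr_of_eventuallyEq (heq x hx)
  have hd' : EqOn (deriv (IccExtend zero_le_one f)) p (Ioo 0 1) := fun x hx => (hd x hx).deriv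
  have hpd : ∀ x ∈ Ioo (0 : ℝ) 1, HasDerivAt p
      (2 * (scaleDensity a b x * -(2 * a x / b x) * flux a b h x +
        scaleDensity a b x * (IccExtend zero_le_one h x * speedDensity a b x))) x := fun x hx =>
    ((hT.hasDerivAt_scaleDensity hx).mul (hT.hasDerivAt_flux h hx)).const_mul 2
  have hdd : ∀ x ∈ Ioo (0 : ℝ) 1, HasDerivAt (deriv (IccExtend zero_le_one f))
      (2 * (scaleDensity a b x * -(2 * a x / b x) * flux a b h x +
        scaleDensity a b x * (IccExtend zero_le_one h x * speedDensity a b x))) x := fun x hx =>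
    (hpd x hx).congr_of_eventuallyEq
      (hd'.eventuallyEq_of_mem (isOpen_Ioo.mem_nhds hx))
  have hratio : ∀ x ∈ Ioo (0 : ℝ) 1,
      deriv (IccExtend zero_le_one f) x / scaleDensity a b x = 2 * flux a b h x := by
    intro x hx
    have hs := (scaleDensity_pos a b x).ne'
    rw [hd' hx, hp]
    field_simp
  refine ⟨?_, ?_, fun _ => ?_, fun _ => ?_⟩
  · have h2 : (2 : WithTop ℕ∞) = 1 + 1 := by norm_num
    rw [h2, contDiffOn_succ_iff_deriv_of_isOpen isOpen_Ioo]
    refine ⟨fun x hx => (hd x hx).differentiableAt.differentiableWithinAt, by simp, ?_⟩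
    have h3 : (1 : WithTop ℕ∞) = 0 + 1 := by norm_num
    rw [h3, contDiffOn_succ_iff_deriv_of_isOpen isOpen_Ioo]
    refine ⟨fun x hx => (hdd x hx).differentiableAt.differentiableWithinAt, by simp, ?_⟩
    rw [contDiffOn_zero]
    refine ContinuousOn.congr ?_ fun x hx => (hdd x hx).deriv
    have hq : ContinuousOn (fun y => 2 * a y / b y) (Ioo (0 : ℝ) 1) :=
      (continuousOn_const.mul hT.drift_continuousOn).div hT.variance_continuousOn
        fun y hy => (hT.variance_pos y hy).ne'
    exact continuousOn_const.mul (((hT.continuousOn_scaleDensity.mul hq.neg).mul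
      ((hT.continuousOn_flux h).mono Ioo_subset_Icc_self)).add
      (hT.continuousOn_scaleDensity.mul (hT.continuousOn_source h)))
  · intro x hx0 hx1
    have hx : (x : ℝ) ∈ Ioo (0 : ℝ) 1 := ⟨hx0, hx1⟩
    have hs := (scaleDensity_pos a b x).ne'
    have hb := (hT.variance_pos x hx).ne'
    rw [(hdd x hx).deriv, hd' hx, hp, IccExtend_val, speedDensity]
    field_simp
    ring
  · have h2 : Tendsto (fun x => 2 * flux a b h x) (𝓝[>] 0) (𝓝 (2 * flux a b h 0)) :=
      (((hT.continuousOn_flux h) 0 (by norm_num)).mono_left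
        (nhdsWithin_le_of_mem (Icc_mem_nhdsGT zero_lt_one))).const_mul 2
    rw [show flux a b h 0 = 0 from intervalIntegral.integral_same, mul_zero] at h2
    refine h2.congr' ?_
    filter_upwards [Ioo_mem_nhdsGT (zero_lt_one (α := ℝ))] with x hx using (hratio x hx).symm
  · have h2 : Tendsto (fun x => 2 * flux a b h x) (𝓝[<] 1) (𝓝 (2 * flux a b h 1)) :=
      (((hT.continuousOn_flux h) 1 (by norm_num)).mono_left
        (nhdsWithin_le_of_mem (Icc_mem_nhdsLT zero_lt_one))).const_mul 2
    rw [h1, mul_zero] at h2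
    refine h2.congr' ?_
    filter_upwards [Ioo_mem_nhdsLT (zero_lt_one (α := ℝ))] with x hx using (hratio x hx).symm

lemma abs_potential_le {h : C(unitInterval, ℝ)} (h1 : flux a b h 1 = 0) {x : ℝ}
    (hx : x ∈ Icc (0 : ℝ) 1) :
    |potential a b h x| ≤ ∫ y in (0 : ℝ)..1, |2 * (scaleDensity a b y * flux a b h y)| := by
  rw [intervalIntegral.integral_of_le zero_le_one]
  rw [← Real.norm_eq_abs]
  refine (intervalIntegral.norm_integral_le_integral_norm_uIoc).trans ?_
  refine setIntegral_mono_set ?_ (Eventually.of_forall fun _ => norm_nonneg _)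
    (LE.le.eventuallyLE ?_)
  · exact ((intervalIntegrable_iff_integrableOn_Ioc_of_le zero_le_one).1
      (hT.intervalIntegrable_scale_mul_flux h1)).norm
  · refine Ioc_subset_Ioc ?_ ?_
    · exact le_min (by norm_num) hx.1
    · exact max_le (by norm_num) hx.2

/-- Centred continuous functions are in the range of the generator. -/
lemma exists_generator_eq {h : C(unitInterval, ℝ)} (h1 : flux a b h 1 = 0) :
    ∃ f, T.Generator f h ∧
      ‖f‖ ≤ ∫ y in (0 : ℝ)..1, |2 * (scaleDensity a b y * flux a b h y)| := by
  refine ⟨⟨fun x => potential a b h x, continuousOn_iff_continuous_domRestrict.1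
    (hT.continuousOn_potential h1)⟩, (hT.generator_iff _ _).2
    (hT.memGraph_potential h1 fun _ => rfl), ?_⟩
  refine (ContinuousMap.norm_le _ ((abs_nonneg _).trans
    (hT.abs_potential_le h1 (left_mem_Icc.2 zero_le_one)))).2 fun x => ?_
  exact hT.abs_potential_le h1 x.2

/-- The solutions of `A f = h` depend continuously on the source in `L¹(dM)`, for bounded
sources. -/
lemma tendsto_integral_scale_mul_flux {h : ℕ → C(unitInterval, ℝ)}
    (h1 : ∀ n, flux a b (h n) 1 = 0) {K : ℝ} (hK : ∀ n, ‖h n‖ ≤ K)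
    (hlim : Tendsto (fun n => ∫ y in (0 : ℝ)..1, |IccExtend zero_le_one (h n) y| *
      speedDensity a b y) atTop (𝓝 0)) :
    Tendsto (fun n => ∫ y in (0 : ℝ)..1, |2 * (scaleDensity a b y * flux a b (h n) y)|)
      atTop (𝓝 0) := by
  simp only [intervalIntegral.integral_of_le (zero_le_one (α := ℝ)),
    integral_Ioc_eq_integral_Ioo (x := (0 : ℝ)) (y := 1)
      (f := fun y => |2 * (scaleDensity a b y * flux a b (h _) y)|)]
  have h0 : (0 : ℝ) = ∫ y in Ioo (0 : ℝ) 1, (0 : ℝ) := by simp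
  suffices h2 : Tendsto (fun n => ∫ y in Ioo (0 : ℝ) 1,
      |2 * (scaleDensity a b y * flux a b (h n) y)|) atTop (𝓝 (∫ y in Ioo (0 : ℝ) 1, (0 : ℝ))) by
    rwa [← h0] at h2
  -- The flux tends to zero pointwise by the L¹ bound, and s · `tailSpeed`, integrable because N(0)
  -- and N(1) are finite, dominates.
  refine tendsto_integral_of_dominated_convergence
    (fun y => 2 * (K * (scaleDensity a b y * tailSpeed a b y)))
    (fun n => (hT.continuousOn_scale_mul_flux (h n)).abs.aestronglyMeasurable measurableSet_Ioo)
    ((hT.integrableOn_scale_mul_tailSpeed.const_mul K).const_mul 2)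
    (fun n => ae_restrict_of_forall_mem measurableSet_Ioo fun x hx => ?_)
    (ae_restrict_of_forall_mem measurableSet_Ioo fun x hx => ?_)
  · rw [Real.norm_eq_abs, abs_abs]
    refine (hT.abs_scale_mul_flux_le (h1 n) hx).trans ?_
    have hB : 0 ≤ scaleDensity a b x * tailSpeed a b x := by
      refine mul_nonneg (scaleDensity_pos a b x).le ?_
      unfold tailSpeed
      split_ifs
      · refine intervalIntegral.integral_nonneg_of_ae_restrict hx.1.le ?_
        rw [Measure.restrict_congr_set Ioo_ae_eq_Icc.symm]
        exact ae_restrict_of_forall_mem measurableSet_Ioo fun y hy =>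
          (hT.speedDensity_pos ⟨hy.1, hy.2.trans hx.2⟩).le
      · refine intervalIntegral.integral_nonneg_of_ae_restrict hx.2.le ?_
        rw [Measure.restrict_congr_set Ioo_ae_eq_Icc.symm]
        exact ae_restrict_of_forall_mem measurableSet_Ioo fun y hy =>
          (hT.speedDensity_pos ⟨hx.1.trans hy.1, hy.2⟩).le
    gcongr
    exact hK n
  · have hf : Tendsto (fun n => flux a b (h n) x) atTop (𝓝 0) :=
      squeeze_zero_norm (fun n => hT.abs_flux_le (h n) (Ioo_subset_Icc_self hx)) hlim
    simpa using ((hf.const_mul (scaleDensity a b x)).const_mul 2).abs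

end IsReflectingOrEntrance
end Diffusion

/-! ### The stationary distribution -/

lemma integrable_continuousMap (μ : Measure unitInterval) [IsFiniteMeasure μ]
    (f : C(unitInterval, ℝ)) : Integrable f μ :=
  f.continuous.integrable_of_hasCompactSupport (HasCompactSupport.of_compactSpace f)

lemma speedMeasure_singleton_zero (a b : ℝ → ℝ) : speedMeasure a b {0} = 0 := by
  rw [speedMeasure, (MeasurableEmbedding.subtype_coe measurableSet_Icc).comap_apply]
  refine withDensity_absolutelyContinuous _ _ ?_
  simp

lemma stationaryMeasure_singleton_zero (a b : ℝ → ℝ) : stationaryMeasure a b {0} = 0 := by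
  rw [stationaryMeasure, Measure.smul_apply, speedMeasure_singleton_zero, smul_zero]

section Diffusion

variable {a b : ℝ → ℝ} {T : FellerSemigroup} (hT : IsReflectingOrEntrance a b T)
include hT

namespace IsReflectingOrEntrance

lemma speedMeasure_univ_ne_top : speedMeasure a b univ ≠ ∞ := by
  have h := hT.integrableOn_speedDensity.lintegral_lt_top
  rw [speedMeasure, (MeasurableEmbedding.subtype_coe measurableSet_Icc).comap_apply]
  refine ne_top_of_le_ne_top h.ne ((measure_mono (subset_univ _)).trans ?_)
  rw [withDensity_apply _ MeasurableSet.univ, Measure.restrict_univ]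

/-- The speed density is positive on (0,1), so null sets of the speed measure are Lebesgue null
there. This makes every conditioning on (0,x] legitimate. -/
lemma speedMeasure_Ioc_ne_zero {x y : unitInterval} (hxy : x < y) :
    speedMeasure a b (Ioc x y) ≠ 0 := by
  rw [speedMeasure, (MeasurableEmbedding.subtype_coe measurableSet_Icc).comap_apply]
  intro h
  have hac := withDensity_absolutelyContinuous' hT.aemeasurable_speedDensity
    (ae_restrict_of_forall_mem measurableSet_Ioo fun y hy =>
      (ENNReal.ofReal_pos.2 (hT.speedDensity_pos hy)).ne')
  have h0 := hac h
  have hsub : Ioo (x : ℝ) y ⊆ (Subtype.val '' Ioc x y) ∩ Ioo (0 : ℝ) 1 := fun z hz =>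
    have hz' : z ∈ Ioo (0 : ℝ) 1 := ⟨x.2.1.trans_lt hz.1, hz.2.trans_le y.2.2⟩
    ⟨⟨⟨z, Ioo_subset_Icc_self hz'⟩, ⟨hz.1, hz.2.le⟩, rfl⟩, hz'⟩
  have h1 := (measure_mono hsub).trans (Measure.le_restrict_apply (μ := volume) _ _)
  rw [h0, Real.volume_Ioo, nonpos_iff_eq_zero, ENNReal.ofReal_eq_zero, sub_nonpos] at h1
  exact absurd h1 (not_le.2 hxy)

lemma speedMeasure_univ_ne_zero : speedMeasure a b univ ≠ 0 := fun h =>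
  hT.speedMeasure_Ioc_ne_zero (zero_lt_one (α := unitInterval)) (measure_mono_null (subset_univ _) h)

lemma isProbabilityMeasure_stationaryMeasure : IsProbabilityMeasure (stationaryMeasure a b) :=
  ⟨by rw [stationaryMeasure, Measure.smul_apply, smul_eq_mul, ENNReal.inv_mul_cancel
    hT.speedMeasure_univ_ne_zero hT.speedMeasure_univ_ne_top]⟩

lemma stationaryMeasure_Ioc_ne_zero {x y : unitInterval} (hxy : x < y) :
    stationaryMeasure a b (Ioc x y) ≠ 0 := by
  rw [stationaryMeasure, Measure.smul_apply, smul_eq_mul]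
  exact mul_ne_zero (ENNReal.inv_ne_zero.2 hT.speedMeasure_univ_ne_top)
    (hT.speedMeasure_Ioc_ne_zero hxy)

lemma integral_source_eq (f : unitInterval → ℝ) :
    ∫ y in (0 : ℝ)..1, IccExtend zero_le_one f y * speedDensity a b y
      = (speedMeasure a b univ).toReal * ∫ x, f x ∂(stationaryMeasure a b) := by
  have h1 : ∫ x, f x ∂(speedMeasure a b)
      = ∫ y in (0 : ℝ)..1, IccExtend zero_le_one f y * speedDensity a b y := by
    have h2 := integral_subtype_comap (measurableSet_Icc (a := (0 : ℝ)) (b := 1))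
      (IccExtend (zero_le_one (α := ℝ)) f)
      (μ := (volume.restrict (Ioo (0 : ℝ) 1)).withDensity
        fun x => ENNReal.ofReal (speedDensity a b x))
    simp only [IccExtend_val] at h2
    rw [speedMeasure]
    refine h2.trans ?_
    rw [restrict_withDensity measurableSet_Icc, Measure.restrict_restrict measurableSet_Icc,
      inter_eq_right.2 Ioo_subset_Icc_self, integral_withDensity_eq_integral_toReal_smul₀
        hT.aemeasurable_speedDensity (Eventually.of_forall fun _ => ENNReal.ofReal_lt_top),
      intervalIntegral.integral_of_le zero_le_one, integral_Ioc_eq_integral_Ioo]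
    refine setIntegral_congr_fun measurableSet_Ioo fun y hy => ?_
    simp only [smul_eq_mul]
    rw [ENNReal.toReal_ofReal (hT.speedDensity_pos hy).le, mul_comm]
  rw [← h1, stationaryMeasure, integral_smul_measure, smul_eq_mul, ENNReal.toReal_inv,
    mul_inv_cancel_left₀]
  exact (ENNReal.toReal_pos hT.speedMeasure_univ_ne_zero hT.speedMeasure_univ_ne_top).ne'

lemma flux_one_eq_zero {h : C(unitInterval, ℝ)} (h0 : ∫ x, h x ∂(stationaryMeasure a b) = 0) :
    flux a b h 1 = 0 := by
  rw [flux, hT.integral_source_eq, h0, mul_zero]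

lemma exists_generator_of_integral_eq_zero {h : C(unitInterval, ℝ)}
    (h0 : ∫ x, h x ∂(stationaryMeasure a b) = 0) : ∃ f, T.Generator f h :=
  let ⟨f, hf, _⟩ := hT.exists_generator_eq (hT.flux_one_eq_zero h0)
  ⟨f, hf⟩

lemma exists_generator_seq {h : ℕ → C(unitInterval, ℝ)}
    (h0 : ∀ n, ∫ x, h n x ∂(stationaryMeasure a b) = 0) {K : ℝ} (hK : ∀ n, ‖h n‖ ≤ K)
    (hlim : Tendsto (fun n => ∫ x, |h n x| ∂(stationaryMeasure a b)) atTop (𝓝 0)) :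
    ∃ f : ℕ → C(unitInterval, ℝ), (∀ n, T.Generator (f n) (h n)) ∧ Tendsto f atTop (𝓝 0) := by
  choose f hf hf' using fun n => hT.exists_generator_eq (hT.flux_one_eq_zero (h0 n))
  refine ⟨f, hf, squeeze_zero_norm hf' (hT.tendsto_integral_scale_mul_flux
    (fun n => hT.flux_one_eq_zero (h0 n)) hK ?_)⟩
  have h1 := hlim.const_mul (speedMeasure a b univ).toReal
  rw [mul_zero] at h1
  exact h1.congr fun n => (hT.integral_source_eq fun x => |h n x|).symm

/-- With h = T_t g - g and c = ∫ h dΠ, both h and h - c are in the range of the generator, hence so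
is the constant c, say as the image of w. Then T_r w - w = rc for all r, while the left side is
bounded by 2‖w‖; so c = 0. -/
lemma isStationary : IsStationary T (stationaryMeasure a b) := by
  have hP := hT.isProbabilityMeasure_stationaryMeasure
  refine ⟨hP, fun t g => ?_⟩
  have hint := integrable_continuousMap (stationaryMeasure a b)
  set h := T.op t g - g with hh
  set c := ∫ x, h x ∂(stationaryMeasure a b) with hc
  have hgF : T.Generator (∫ r in (0 : ℝ)..t, T.op r.toNNReal g) h := by
    simpa only [Real.toNNReal_coe] using T.generator_integral g t.coe_nonneg
  obtain ⟨f, hf⟩ := hT.exists_generator_of_integral_eq_zero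
    (h := h - c • (1 : C(unitInterval, ℝ))) (by
      have : ∀ x, (h - c • (1 : C(unitInterval, ℝ))) x = h x - c := fun x => by simp
      simp only [this]
      rw [integral_sub (hint h) (integrable_const c), ← hc]
      simp)
  have hw := hgF.sub hf
  rw [sub_sub_cancel] at hw
  set w := (∫ r in (0 : ℝ)..t, T.op r.toNNReal g) - f
  have hbd : ∀ r : ℝ, 0 ≤ r → r * |c| ≤ 2 * ‖w‖ := fun r hr => by
    have h1 := hw.op_sub_eq_integral hr
    simp only [map_smul, T.op_one, intervalIntegral.integral_const, sub_zero] at h1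
    have h2 : ‖T.op r.toNNReal w - w‖ ≤ 2 * ‖w‖ :=
      (norm_sub_le _ _).trans (by linarith [T.norm_op_le r.toNNReal w])
    rwa [h1, norm_smul, norm_smul, norm_one, mul_one, Real.norm_of_nonneg hr,
      Real.norm_eq_abs] at h2
  have hc0 : c = 0 := by
    by_contra hne
    have hpos : 0 < |c| := abs_pos.2 hne
    have := hbd ((2 * ‖w‖ + 1) / |c|) (by positivity)
    rw [div_mul_cancel₀ _ hpos.ne'] at this
    linarith
  have h3 : c = ∫ x, T.op t g x ∂(stationaryMeasure a b) - ∫ x, g x ∂(stationaryMeasure a b) :=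
    integral_sub (hint _) (hint _)
  linarith

end IsReflectingOrEntrance
end Diffusion

/-! ### Continuous functions approximating the indicator of `0` -/

/-- The spike `x ↦ max 0 (1 - n x)`. -/
def spike (n : ℕ) : C(unitInterval, ℝ) :=
  ⟨fun x => max 0 (1 - n * x), by fun_prop⟩

lemma spike_apply (n : ℕ) (x : unitInterval) : spike n x = max 0 (1 - n * (x : ℝ)) := rfl

lemma spike_zero (n : ℕ) : spike n 0 = 1 := by simp [spike_apply]

lemma spike_apply_nonneg (n : ℕ) (x : unitInterval) : 0 ≤ spike n x := le_max_left _ _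

lemma spike_nonneg (n : ℕ) : 0 ≤ spike n := spike_apply_nonneg n

lemma spike_le_one (n : ℕ) (x : unitInterval) : spike n x ≤ 1 :=
  max_le zero_le_one (sub_le_self _ (mul_nonneg n.cast_nonneg x.2.1))

lemma norm_spike_le (n : ℕ) : ‖spike n‖ ≤ 1 :=
  (ContinuousMap.norm_le _ zero_le_one).2 fun x => by
    rw [Real.norm_of_nonneg (spike_apply_nonneg n x)]
    exact spike_le_one n x

lemma spike_antitone : Antitone spike := fun _ _ hmn x =>
  max_le_max le_rfl (sub_le_sub_left
    (mul_le_mul_of_nonneg_right (Nat.cast_le.2 hmn) x.2.1) _)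

lemma tendsto_spike {x : unitInterval} (hx : x ≠ 0) :
    Tendsto (fun n => spike n x) atTop (𝓝 0) := by
  have hx' : 0 < (x : ℝ) := unitInterval.pos_iff_ne_zero.2 hx
  obtain ⟨N, hN⟩ := exists_nat_ge ((x : ℝ)⁻¹)
  refine tendsto_const_nhds.congr' ?_
  filter_upwards [eventually_ge_atTop N] with n hn
  rw [spike_apply, max_eq_left]
  have h1 : (x : ℝ)⁻¹ ≤ n := hN.trans (Nat.cast_le.2 hn)
  rw [inv_le_iff_one_le_mul₀ hx'] at h1
  linarith

lemma tendsto_integral_spike (μ : Measure unitInterval) [IsFiniteMeasure μ] (h0 : μ {0} = 0) :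
    Tendsto (fun n => ∫ x, spike n x ∂μ) atTop (𝓝 0) := by
  have h := tendsto_integral_of_dominated_convergence (μ := μ) (F := fun n x => spike n x)
    (f := fun _ => 0) (fun _ => (1 : ℝ)) (fun n => (spike n).continuous.aestronglyMeasurable)
    (integrable_const _)
    (fun n => Eventually.of_forall fun x => ((spike n).norm_coe_le_norm x).trans (norm_spike_le n))
    (by
      have : ∀ᵐ x ∂μ, x ≠ 0 := measure_eq_zero_iff_ae_notMem.1 h0
      filter_upwards [this] with x hx using tendsto_spike hx)
  simpa using h

/-- The limit of T_r(spike_n)(0) is the probability that the process started at 0 is at 0 at time r.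
Its integral over r ∈ (0,t] is shown to vanish, so it is zero for some such r. -/
lemma IsReflectingOrEntrance.exists_tendsto_op_spike {a b : ℝ → ℝ} {T : FellerSemigroup}
    (hT : IsReflectingOrEntrance a b T) {t : ℝ≥0} (ht : 0 < t) :
    ∃ r ≤ t, Tendsto (fun n => T.op r (spike n) 0) atTop (𝓝 0) := by
  have hP := hT.isProbabilityMeasure_stationaryMeasure
  have hint := integrable_continuousMap (stationaryMeasure a b)
  have hanti : ∀ r, Antitone fun n => T.op r (spike n) 0 := fun r m n hmn =>
    T.op_mono r (spike_antitone hmn) 0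
  have hnn : ∀ r n, 0 ≤ T.op r (spike n) 0 := fun r n => T.op_nonneg r _ (spike_nonneg n) 0
  have hle : ∀ r n, T.op r (spike n) 0 ≤ 1 := fun r n =>
    (le_abs_self _).trans (((T.op r (spike n)).norm_coe_le_norm 0).trans
      ((T.norm_op_le r _).trans (norm_spike_le n)))
  have hlim : ∀ r, Tendsto (fun n => T.op r (spike n) 0) atTop
      (𝓝 (⨅ n, T.op r (spike n) 0)) := fun r =>
    tendsto_atTop_ciInf (hanti r) ⟨0, by rintro _ ⟨n, rfl⟩; exact hnn r n⟩
  have hcont : ∀ (f : C(unitInterval, ℝ)), Continuous fun r : ℝ => T.op r.toNNReal f 0 := fun f =>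
    (continuous_eval_const (0 : unitInterval)).comp (T.continuous_op_toNNReal f)
  have heval : ∀ f : C(unitInterval, ℝ), (∫ r in (0 : ℝ)..t, T.op r.toNNReal f) 0
      = ∫ r in (0 : ℝ)..t, T.op r.toNNReal f 0 := fun f =>
    (ContinuousLinearMap.intervalIntegral_comp_comm (ContinuousMap.evalCLM ℝ (0 : unitInterval))
      ((T.continuous_op_toNNReal f).intervalIntegrable 0 t)).symm
  set c : ℕ → ℝ := fun n => ∫ x, spike n x ∂(stationaryMeasure a b) with hc
  have hc0 : Tendsto c atTop (𝓝 0) :=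
    tendsto_integral_spike _ (stationaryMeasure_singleton_zero a b)
  have hcnn : ∀ n, 0 ≤ c n := fun n => integral_nonneg (spike_nonneg n)
  have hc1 : ∀ n, c n ≤ 1 := fun n => by
    simpa using integral_mono (hint (spike n)) (integrable_const 1) (spike_le_one n)
  -- Subtracting the mean makes the spike a centred source. It stays bounded by 1, and its L¹(Π)
  -- norm is at most 2 c_n → 0, so the solutions f_n tend uniformly to zero.
  set h : ℕ → C(unitInterval, ℝ) := fun n => spike n - c n • 1 with hh
  have hhx : ∀ n x, h n x = spike n x - c n := fun n x => by simp [hh]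
  obtain ⟨f, hf, hf0⟩ := hT.exists_generator_seq (h := h) (K := 1)
    (fun n => by
      simp only [hhx]
      rw [integral_sub (hint _) (integrable_const _)]
      simp [hc])
    (fun n => (ContinuousMap.norm_le _ zero_le_one).2 fun x => by
      rw [hhx, Real.norm_eq_abs, abs_le]
      have h1 := spike_apply_nonneg n x
      have h2 := spike_le_one n x
      constructor <;> linarith [hcnn n, hc1 n])
    (by
      refine squeeze_zero (g := fun n => c n + c n) (fun n => integral_nonneg fun x => abs_nonneg _)
        (fun n => ?_) (by simpa using hc0.add hc0)
      have h1 : ∫ x, (spike n x + c n) ∂(stationaryMeasure a b) = c n + c n := by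
        rw [integral_add (hint _) (integrable_const _)]
        simp [hc]
      rw [← h1]
      refine integral_mono (hint _).abs ((hint _).add (integrable_const _)) fun x => ?_
      simp only [hhx]
      have h2 := spike_apply_nonneg n x
      exact (abs_sub _ _).trans_eq (by rw [abs_of_nonneg h2, abs_of_nonneg (hcnn n)]))
  have hI : Tendsto (fun n => ∫ r in (0 : ℝ)..t, T.op r.toNNReal (spike n) 0) atTop (𝓝 0) := by
    -- Dynkin's formula for f_n at 0, with the subtracted mean contributing t · c_n.
    have h1 : ∀ n, ∫ r in (0 : ℝ)..t, T.op r.toNNReal (spike n) 0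
        = (T.op t (f n) - f n) 0 + t * c n := fun n => by
      have h2 := (hf n).op_sub_eq_integral t.coe_nonneg
      rw [Real.toNNReal_coe] at h2
      rw [h2, heval, ← sub_eq_iff_eq_add, ← heval]
      have h4 : ∀ r : ℝ, T.op r.toNNReal (h n) 0 = T.op r.toNNReal (spike n) 0 - c n :=
        fun r => by simp [hh, map_sub, map_smul, T.op_one]
      simp only [h4]
      rw [intervalIntegral.integral_sub ((hcont _).intervalIntegrable _ _)
        intervalIntegrable_const, heval]
      simp
    simp only [h1]
    have h5 : Tendsto (fun n => (T.op t (f n) - f n) 0) atTop (𝓝 0) := by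
      have : Continuous fun g : C(unitInterval, ℝ) => (T.op t g - g) 0 :=
        (continuous_eval_const (0 : unitInterval)).comp ((T.op t).continuous.sub continuous_id)
      simpa [Function.comp_def] using (this.tendsto 0).comp hf0
    simpa using h5.add (hc0.const_mul (t : ℝ))
  have hD : Tendsto (fun n => ∫ r in (0 : ℝ)..t, T.op r.toNNReal (spike n) 0) atTop
      (𝓝 (∫ r in (0 : ℝ)..t, ⨅ n, T.op r.toNNReal (spike n) 0)) :=
    intervalIntegral.tendsto_integral_filter_of_dominated_convergence (fun _ => 1)
      (Eventually.of_forall fun n => (hcont _).aestronglyMeasurable)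
      (Eventually.of_forall fun n => Eventually.of_forall fun r _ => by
        rw [Real.norm_of_nonneg (hnn _ _)]; exact hle _ _)
      intervalIntegrable_const
      (Eventually.of_forall fun r _ => hlim _)
  have hzero := tendsto_nhds_unique hD hI
  have hmeas : Measurable fun r : ℝ => ⨅ n, T.op r.toNNReal (spike n) 0 :=
    Measurable.iInf fun n => (hcont _).measurable
  have hq0 : ∀ r : ℝ, 0 ≤ ⨅ n, T.op r.toNNReal (spike n) 0 := fun r =>
    le_ciInf fun n => hnn _ n
  have hqi : IntervalIntegrable (fun r : ℝ => ⨅ n, T.op r.toNNReal (spike n) 0) volume 0 t :=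
    (intervalIntegrable_const (c := (1 : ℝ))).mono_fun hmeas.aestronglyMeasurable
      (Eventually.of_forall fun r => by
        change ‖_‖ ≤ ‖(1 : ℝ)‖
        rw [Real.norm_of_nonneg (hq0 r), norm_one]
        exact (ciInf_le ⟨0, by rintro _ ⟨n, rfl⟩; exact hnn _ n⟩ 0).trans (hle _ 0))
  rw [intervalIntegral.integral_of_le t.coe_nonneg, integral_eq_zero_iff_of_nonneg hq0 hqi.1] at hzero
  have hne : (ae (volume.restrict (Ioc (0 : ℝ) t))).NeBot := by
    rw [ae_neBot, Ne, Measure.restrict_eq_zero, Real.volume_Ioc]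
    simpa using ht.ne'
  obtain ⟨r, hr, hr'⟩ := (hzero.and (ae_restrict_mem measurableSet_Ioc)).exists
  refine ⟨r.toNNReal, Real.toNNReal_le_iff_le_coe.2 hr'.2, ?_⟩
  have h6 := hlim r.toNNReal
  rwa [show ⨅ n, T.op r.toNNReal (spike n) 0 = 0 from hr] at h6


/-! ### Finite-dimensional consequences of the Markov property -/

namespace IsFellerDiffusion

variable {T : FellerSemigroup} {Ω : Type*} [MeasurableSpace Ω] {P : Measure Ω}
  [IsProbabilityMeasure P] {X : ℝ≥0 → Ω → unitInterval} (hX : IsFellerDiffusion T P X)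
include hX

lemma integrable_comp (f : C(unitInterval, ℝ)) (t : ℝ≥0) : Integrable (fun ω => f (X t ω)) P :=
  Integrable.of_bound (f.continuous.measurable.comp (hX.measurable t)).aestronglyMeasurable ‖f‖
    (Eventually.of_forall fun _ => f.norm_coe_le_norm _)

lemma setIntegral_op (s t : ℝ≥0) (f : C(unitInterval, ℝ)) {A : Set Ω}
    (hA : MeasurableSet[Filtration.natural X
      (fun i => (hX.measurable i).stronglyMeasurable) s] A) :
    ∫ ω in A, f (X (s + t) ω) ∂P = ∫ ω in A, T.op t f (X s ω) ∂P := by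
  have hm := (Filtration.natural X (fun i => (hX.measurable i).stronglyMeasurable)).le s
  rw [← setIntegral_condExp hm (hX.integrable_comp f (s + t)) hA]
  exact setIntegral_congr_ae (hm A hA) ((hX.markov s t f).mono fun ω hω _ => hω)

lemma integral_law (t : ℝ≥0) (f : C(unitInterval, ℝ)) :
    ∫ x, f x ∂(P.map (X t)) = ∫ x, T.op t f x ∂(P.map (X 0)) := by
  rw [integral_map (hX.measurable t).aemeasurable f.continuous.aestronglyMeasurable,
    integral_map (hX.measurable 0).aemeasurable (T.op t f).continuous.aestronglyMeasurable]
  have h := hX.setIntegral_op 0 t f (A := univ) MeasurableSet.univ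
  simpa using h

end IsFellerDiffusion

/-! ### The link operator -/

section Link

variable {Pi : Measure unitInterval}

lemma truncated_zero (Pi : Measure unitInterval) : truncated Pi 0 = Measure.dirac 0 := if_pos rfl

lemma truncated_of_ne {x : unitInterval} (hx : x ≠ 0) :
    truncated Pi x = ProbabilityTheory.cond Pi (Ioc 0 x) := if_neg hx

lemma truncated_apply {x : unitInterval} (hx : x ≠ 0) (A : Set unitInterval) :
    truncated Pi x A = (Pi (Ioc 0 x))⁻¹ * Pi (Ioc 0 x ∩ A) := by
  rw [truncated_of_ne hx, cond_apply measurableSet_Ioc]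

variable [IsProbabilityMeasure Pi]

lemma truncated_one (h0 : Pi {0} = 0) : truncated Pi 1 = Pi := by
  have h1 : ∀ᵐ x ∂Pi, x ∈ Ioc (0 : unitInterval) 1 := by
    filter_upwards [measure_eq_zero_iff_ae_notMem.1 h0] with x hx
    exact ⟨unitInterval.pos_iff_ne_zero.2 hx, unitInterval.le_one'⟩
  rw [truncated_of_ne one_ne_zero, ProbabilityTheory.cond, Measure.restrict_eq_self_of_ae_mem h1,
    prob_compl_eq_zero_iff measurableSet_Ioc |>.1 h1, inv_one, one_smul]

lemma measurable_truncated (Pi : Measure unitInterval) [IsProbabilityMeasure Pi] :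
    Measurable (truncated Pi) := by
  refine Measure.measurable_of_measurable_coe _ fun A _ => ?_
  have hm : ∀ B : Set unitInterval, Measurable fun x => Pi (Ioc 0 x ∩ B) := fun B =>
    Monotone.measurable fun x y hxy =>
      measure_mono (inter_subset_inter_left _ (Ioc_subset_Ioc_right hxy))
  have h1 : (fun x => truncated Pi x A) = fun x => if x = 0 then Measure.dirac 0 A
      else (Pi (Ioc 0 x ∩ univ))⁻¹ * Pi (Ioc 0 x ∩ A) := by
    ext x
    split_ifs with hx
    · rw [hx, truncated_zero]
    · rw [truncated_apply hx, inter_univ]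
  rw [h1]
  exact Measurable.ite (measurableSet_singleton 0) measurable_const ((hm univ).inv.mul (hm A))

/-- Only the truncation at 0, which is δ₀, can fail to be absolutely continuous, and the mixing law
gives it no weight. -/
lemma bind_truncated_absolutelyContinuous {ν : Measure unitInterval} (hν : ν {0} = 0) : ν.bind (truncated Pi) ≪ Pi := by
  refine Measure.AbsolutelyContinuous.mk fun A hA hA0 => ?_
  rw [Measure.bind_apply hA (measurable_truncated Pi).aemeasurable]
  refine (lintegral_congr_ae ?_).trans lintegral_zero
  filter_upwards [measure_eq_zero_iff_ae_notMem.1 hν] with x hx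
  rw [truncated_apply hx, measure_mono_null inter_subset_right hA0, mul_zero]

lemma link_one (h0 : Pi {0} = 0) (f : unitInterval → ℝ) : link Pi f 1 = ∫ x, f x ∂Pi := by
  rw [link, truncated_one h0]

lemma link_zero (Pi : Measure unitInterval) (f : unitInterval → ℝ) : link Pi f 0 = f 0 := by
  rw [link, truncated_zero, integral_dirac]

variable (hpos : ∀ x y : unitInterval, x < y → Pi (Ioc x y) ≠ 0)
include hpos

lemma isProbabilityMeasure_truncated (x : unitInterval) :
    IsProbabilityMeasure (truncated Pi x) := by
  rcases eq_or_ne x 0 with rfl | hx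
  · rw [truncated_zero]; infer_instance
  · rw [truncated_of_ne hx]
    exact cond_isProbabilityMeasure (hpos 0 x (unitInterval.pos_iff_ne_zero.2 hx))

lemma link_add (f g : C(unitInterval, ℝ)) (x : unitInterval) :
    link Pi (f + g : C(unitInterval, ℝ)) x = link Pi f x + link Pi g x := by
  have := isProbabilityMeasure_truncated hpos x
  exact integral_add (integrable_continuousMap _ f) (integrable_continuousMap _ g)

lemma abs_link_le (f : C(unitInterval, ℝ)) (x : unitInterval) : |link Pi f x| ≤ ‖f‖ := by
  have := isProbabilityMeasure_truncated hpos x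
  have h := norm_integral_le_of_norm_le_const (μ := truncated Pi x)
    (Eventually.of_forall fun y => f.norm_coe_le_norm y)
  rwa [probReal_univ, mul_one] at h

/-- Continuity on the dense domain of the generator extends to all f, because the link contracts the
uniform norm. -/
lemma continuous_link {T : FellerSemigroup}
    (h : ∀ f g, T.Generator f g → Continuous (link Pi f)) (f : C(unitInterval, ℝ)) :
    Continuous (link Pi f) := by
  refine continuous_of_uniform_approx_of_continuous fun u hu => ?_
  obtain ⟨ε, hε, hεu⟩ := Metric.mem_uniformity_dist.1 hu
  obtain ⟨f', g', hfg, hlt⟩ := T.exists_generator_norm_sub_lt f hε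
  refine ⟨link Pi f', h f' g' hfg, fun y => hεu ?_⟩
  have e := link_add hpos (f' - f) f y
  rw [sub_add_cancel] at e
  rw [dist_comm, Real.dist_eq, e, add_sub_cancel_right]
  exact (abs_link_le hpos _ y).trans_lt hlt

/-- The link as a bounded operator on `C([0,1])`. -/
lemma exists_linkCLM {T : FellerSemigroup}
    (h : ∀ f g, T.Generator f g → Continuous (link Pi f)) :
    ∃ L : C(unitInterval, ℝ) →L[ℝ] C(unitInterval, ℝ), ∀ f x, L f x = link Pi f x :=
  ⟨LinearMap.mkContinuous
    { toFun := fun f => ⟨link Pi f, continuous_link hpos h f⟩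
      map_add' := fun f g => ContinuousMap.ext fun x => link_add hpos f g x
      map_smul' := fun c f => ContinuousMap.ext fun x => integral_const_mul c f } 1
    fun f => by
      rw [one_mul]
      exact (ContinuousMap.norm_le _ (norm_nonneg f)).2 fun x => abs_link_le hpos f x,
    fun _ _ => rfl⟩

omit [IsProbabilityMeasure Pi] hpos in
lemma lintegral_coe_eq_ofReal_integral (μ : Measure unitInterval) [IsFiniteMeasure μ]
    (f : C(unitInterval, ℝ)) (hf : 0 ≤ f) :
    ∫⁻ x, ENNReal.ofReal (f x) ∂μ = ENNReal.ofReal (∫ x, f x ∂μ) :=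
  (ofReal_integral_eq_lintegral_ofReal (integrable_continuousMap μ f)
    (Eventually.of_forall hf)).symm

/-- A law whose integrals are the averages of the link is a mixture of the truncations. -/
lemma eq_bind_truncated {L : C(unitInterval, ℝ) →L[ℝ] C(unitInterval, ℝ)}
    (hL : ∀ f x, L f x = link Pi f x) {μ ν : Measure unitInterval} [IsFiniteMeasure μ]
    [IsFiniteMeasure ν] (h : ∀ f : C(unitInterval, ℝ), ∫ x, f x ∂μ = ∫ x, L f x ∂ν) :
    μ = ν.bind (truncated Pi) := by
  refine ext_of_forall_lintegral_eq_of_IsFiniteMeasure fun f => ?_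
  set g : C(unitInterval, ℝ) := ⟨fun x => (f x : ℝ), by fun_prop⟩ with hg
  have hg0 : 0 ≤ g := fun x => (f x).2
  have hLg : 0 ≤ L g := fun x => by
    change 0 ≤ L g x
    rw [hL]
    exact integral_nonneg hg0
  have hfg : ∀ x, (f x : ℝ≥0∞) = ENNReal.ofReal (g x) := fun x =>
    (ENNReal.ofReal_coe_nnreal (p := f x)).symm
  rw [Measure.lintegral_bind (measurable_truncated Pi).aemeasurable
    (f.continuous.measurable.coe_nnreal_ennreal).aemeasurable]
  simp only [hfg]
  rw [lintegral_coe_eq_ofReal_integral μ g hg0, h, ← lintegral_coe_eq_ofReal_integral ν _ hLg]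
  refine lintegral_congr fun x => ?_
  have := isProbabilityMeasure_truncated hpos x
  rw [lintegral_coe_eq_ofReal_integral _ g hg0, hL]
  rfl

omit hpos in
-- Conditioning Π to (0,x] can only lower the mass to the right of y, and leaves none if x ≤ y.
lemma truncated_Ioi_le (h0 : Pi {0} = 0) (x y : unitInterval) :
    truncated Pi x (Ioi y) ≤ (Ioi y).indicator (fun _ => Pi (Ioi y)) x := by
  by_cases hxy : y < x
  · have hx : x ≠ 0 := (lt_of_le_of_lt unitInterval.nonneg' hxy).ne'
    rw [indicator_of_mem (show x ∈ Ioi y from hxy), truncated_apply hx]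
    have e1 : Ioc 0 x ∩ Ioi y = Ioc y x := by
      rw [Ioc_inter_Ioi, sup_of_le_right unitInterval.nonneg']
    have e2 : Pi (Ioc 0 x) = Pi (Ioc 0 y) + Pi (Ioc y x) := by
      rw [← Ioc_union_Ioc_eq_Ioc unitInterval.nonneg' hxy.le,
        measure_union (Ioc_disjoint_Ioc_of_le le_rfl) measurableSet_Ioc]
    have e3 : Pi (Ioi y) = Pi (Ioc y x) + Pi (Ioi x) := by
      rw [← Ioc_union_Ioi_eq_Ioi hxy.le,
        measure_union (by
          rw [Set.disjoint_left]; exact fun z hz hz' => not_lt.2 hz.2 hz') measurableSet_Ioi]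
    have e4 : Pi (Ioc 0 x) + Pi (Ioi x) = 1 := by
      have h1 := prob_compl_eq_zero_iff (μ := Pi) (measurableSet_singleton 0).compl
      rw [compl_compl] at h1
      rw [← h1.1 h0, ← measure_union (by
          rw [Set.disjoint_left]; exact fun z hz hz' => not_lt.2 hz.2 hz') measurableSet_Ioi,
        Ioc_union_Ioi_eq_Ioi unitInterval.nonneg']
      congr 1
      ext z; simp [unitInterval.pos_iff_ne_zero]
    rw [e1, mul_comm, ← div_eq_mul_inv]
    refine ENNReal.div_le_of_le_mul ?_
    -- Writing 1 = Π(0,x] + Π(x,1], the two sides differ by exactly Π(x,1] · Π(0,y].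
    calc Pi (Ioc y x) = Pi (Ioc y x) * (Pi (Ioc 0 x) + Pi (Ioi x)) := by rw [e4, mul_one]
      _ ≤ Pi (Ioc y x) * (Pi (Ioc 0 x) + Pi (Ioi x)) + Pi (Ioi x) * Pi (Ioc 0 y) := le_self_add
      _ = Pi (Ioi y) * Pi (Ioc 0 x) := by rw [e3, e2]; ring
  · have e : truncated Pi x (Ioi y) = 0 := by
      rcases eq_or_ne x 0 with rfl | hx
      · rw [truncated_zero, Measure.dirac_apply' _ measurableSet_Ioi]
        simp
      · rw [truncated_apply hx, Ioc_inter_Ioi,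
          Ioc_eq_empty fun h : max 0 y < x => hxy (lt_of_le_of_lt le_sup_right h), measure_empty,
          mul_zero]
    rw [e]; exact zero_le

variable {ν : Measure unitInterval} [IsFiniteMeasure ν]

/-- The essential infimum of the density of a mixture of truncations is the mass that the mixing
law gives to the full truncation. -/
lemma essInf_rnDeriv_bind_truncated (h0 : Pi {0} = 0) (hν : ν {0} = 0)
    [IsFiniteMeasure (ν.bind (truncated Pi))] :
    essInf ((ν.bind (truncated Pi)).rnDeriv Pi) Pi = ν {1} := by
  have hac := bind_truncated_absolutelyContinuous (Pi := Pi) hν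
  have hbind : ∀ A, MeasurableSet A → ν.bind (truncated Pi) A = ∫⁻ x, truncated Pi x A ∂ν :=
    fun A hA => Measure.bind_apply hA (measurable_truncated Pi).aemeasurable
  refine le_antisymm ?_ ?_
  -- The essential infimum is at most the average of the density over (y,1], which is at most
  -- ν(y,1]. Outer regularity of ν at {1} then lets y approach 1.
  · have hle : ∀ y : unitInterval, y < 1 →
        essInf ((ν.bind (truncated Pi)).rnDeriv Pi) Pi ≤ ν (Ioi y) := by
      intro y hy
      have hne : Pi (Ioi y) ≠ 0 := fun h =>
        hpos y 1 hy (measure_mono_null (fun z hz => hz.1) h)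
      have h1 : essInf ((ν.bind (truncated Pi)).rnDeriv Pi) Pi * Pi (Ioi y)
          ≤ ν (Ioi y) * Pi (Ioi y) := by
        calc _ = ∫⁻ _ in Ioi y, essInf ((ν.bind (truncated Pi)).rnDeriv Pi) Pi ∂Pi := by
              rw [setLIntegral_const]
          _ ≤ ∫⁻ x in Ioi y, (ν.bind (truncated Pi)).rnDeriv Pi x ∂Pi :=
              lintegral_mono_ae (ae_restrict_of_ae ae_essInf_le)
          _ = ν.bind (truncated Pi) (Ioi y) := Measure.setLIntegral_rnDeriv hac _
          _ = ∫⁻ x, truncated Pi x (Ioi y) ∂ν := hbind _ measurableSet_Ioi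
          _ ≤ ∫⁻ x, (Ioi y).indicator (fun _ => Pi (Ioi y)) x ∂ν :=
              lintegral_mono fun x => truncated_Ioi_le h0 x y
          _ = ν (Ioi y) * Pi (Ioi y) := by
              rw [lintegral_indicator_const measurableSet_Ioi, mul_comm]
      exact (ENNReal.mul_le_mul_iff_left hne (measure_ne_top _ _)).1 h1
    refine le_of_forall_gt fun r hr => ?_
    obtain ⟨U, hU1, hUo, hUr⟩ := Set.exists_isOpen_lt_of_lt {1} r hr
    obtain ⟨y, hy, hyU⟩ := exists_Ioc_subset_of_mem_nhds
      (hUo.mem_nhds (hU1 rfl)) ⟨0, zero_lt_one (α := unitInterval)⟩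
    refine ((hle y hy).trans (measure_mono fun z hz => hyU ⟨hz, unitInterval.le_one'⟩)).trans_lt hUr
  -- The atom of ν at 1 contributes ν{1} · Π to the mixture, so the density is at least ν{1} almost
  -- everywhere.
  · refine le_essInf_of_ae_le _ (ae_le_of_forall_setLIntegral_le_of_sigmaFinite measurable_const
      fun A hA _ => ?_)
    rw [setLIntegral_const, Measure.setLIntegral_rnDeriv hac, hbind A hA]
    calc ν {1} * Pi A = ∫⁻ x in {1}, truncated Pi x A ∂ν := by
          rw [lintegral_singleton, truncated_one h0, mul_comm]
      _ ≤ _ := setLIntegral_le_lintegral _ _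

/-- The mean e over (0,x] is at most x, while (x,1] carries positive mass lying strictly above x. So
y - e has zero integral over (0,x] and positive integral over the rest. -/
lemma link_val_lt (h0 : Pi {0} = 0) {x : unitInterval} (hx : x < 1) :
    link Pi (fun y => (y : ℝ)) x < link Pi (fun y => (y : ℝ)) 1 := by
  rw [link_one h0]
  set e := link Pi (fun y => (y : ℝ)) x with he
  have hi : ∀ μ : Measure unitInterval, ∀ [IsFiniteMeasure μ],
      Integrable (fun y : unitInterval => (y : ℝ)) μ := fun μ _ =>
    integrable_continuousMap μ ⟨fun y => (y : ℝ), by fun_prop⟩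
  have hie : Integrable (fun y : unitInterval => (y : ℝ) - e) Pi :=
    (hi Pi).sub (integrable_const e)
  have hIoc : ∫ y in Ioc 0 x, ((y : ℝ) - e) ∂Pi = 0 := by
    rcases eq_or_ne x 0 with rfl | hx0
    · simp
    · have hne := hpos 0 x (unitInterval.pos_iff_ne_zero.2 hx0)
      have h1 : e = (Pi.real (Ioc 0 x))⁻¹ * ∫ y in Ioc 0 x, (y : ℝ) ∂Pi := by
        rw [he, link, truncated_of_ne hx0, ProbabilityTheory.cond, integral_smul_measure,
          smul_eq_mul, ENNReal.toReal_inv]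
        rfl
      have h2 : Pi.real (Ioc 0 x) ≠ 0 := (ENNReal.toReal_pos hne (measure_ne_top _ _)).ne'
      rw [integral_sub (hi _) (integrable_const _), setIntegral_const, smul_eq_mul, h1,
        mul_inv_cancel_left₀ h2, sub_self]
  have hex : e ≤ x := by
    have := isProbabilityMeasure_truncated hpos x
    have h1 : ∀ᵐ y : unitInterval ∂(truncated Pi x), (y : ℝ) ≤ x := by
      rcases eq_or_ne x 0 with rfl | hx0
      · rw [truncated_zero, ae_dirac_eq]; simp
      · rw [truncated_of_ne hx0]
        exact (ae_cond_mem measurableSet_Ioc).mono fun y hy => hy.2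
    have h2 := integral_mono_ae (hi _) (integrable_const (x : ℝ)) h1
    rwa [integral_const, probReal_univ, one_smul] at h2
  have hIoi : 0 < ∫ y in Ioi x, ((y : ℝ) - e) ∂Pi := by
    rw [setIntegral_pos_iff_support_of_nonneg_ae
      (ae_restrict_of_forall_mem measurableSet_Ioi fun y hy => ?_)
      hie.integrableOn]
    · refine (pos_iff_ne_zero.2 (hpos x 1 hx) : 0 < Pi (Ioc x 1)).trans_le (measure_mono fun (y : unitInterval) hy => ⟨?_, hy.1⟩)
      exact (sub_pos.2 (hex.trans_lt hy.1)).ne'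
    · exact sub_nonneg.2 (hex.trans (le_of_lt hy))
  have hsum : ∫ y, ((y : ℝ) - e) ∂Pi = ∫ y in Ioc 0 x, ((y : ℝ) - e) ∂Pi
      + ∫ y in Ioi x, ((y : ℝ) - e) ∂Pi := by
    rw [← setIntegral_union (by
        rw [Set.disjoint_left]; exact fun z hz hz' => not_lt.2 hz.2 hz') measurableSet_Ioi
      hie.integrableOn
      hie.integrableOn, Ioc_union_Ioi_eq_Ioi unitInterval.nonneg',
      Measure.restrict_eq_self_of_ae_mem]
    filter_upwards [measure_eq_zero_iff_ae_notMem.1 h0] with z hz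
    exact unitInterval.pos_iff_ne_zero.2 hz
  rw [hIoc, zero_add, integral_sub (hi _) (integrable_const _)] at hsum
  simp only [integral_const, probReal_univ, one_smul] at hsum
  linarith

end Link

/-! ### Absorption -/

namespace IsFellerDiffusion

variable {T : FellerSemigroup} {Ω : Type*} [MeasurableSpace Ω] {P : Measure Ω}
  [IsProbabilityMeasure P] {X : ℝ≥0 → Ω → unitInterval} (hX : IsFellerDiffusion T P X)
include hX

omit [IsProbabilityMeasure P] in
lemma measurableSet_exists_mem {U : Set unitInterval} (hU : MeasurableSet U) {τ : ℕ → ℝ≥0}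
    {s : ℝ≥0} {N : ℕ} (hτ : ∀ k < N, τ k ≤ s) :
    MeasurableSet[Filtration.natural X (fun i => (hX.measurable i).stronglyMeasurable) s]
      {ω | ∃ k < N, X (τ k) ω ∈ U} := by
  have h : {ω | ∃ k < N, X (τ k) ω ∈ U} = ⋃ k ∈ Finset.range N, X (τ k) ⁻¹' U := by
    ext ω; simp
  rw [h]
  refine MeasurableSet.biUnion (Finset.range N).countable_toSet fun k hk => ?_
  have hm := (Filtration.stronglyAdapted_natural
    (fun i => (hX.measurable i).stronglyMeasurable) (τ k)).measurable hU
  exact (Filtration.natural X (fun i => (hX.measurable i).stronglyMeasurable)).mono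
    (hτ k (Finset.mem_range.1 hk)) _ hm

/-- If `T_r g ≤ ε` on `U` for all `r ≤ t`, then the contribution to `E g(X_t)` of the paths that
visit `U` at one of finitely many times before `t` is at most `ε`. -/
lemma setIntegral_exists_mem_le {g : C(unitInterval, ℝ)} {t : ℝ≥0} {U : Set unitInterval}
    (hU : MeasurableSet U) {ε : ℝ} (hε : ∀ r ≤ t, ∀ x ∈ U, T.op r g x ≤ ε) {τ : ℕ → ℝ≥0}
    (hτ : Monotone τ) {N : ℕ} (hN : ∀ k < N, τ k ≤ t) :
    ∫ ω in {ω | ∃ k < N, X (τ k) ω ∈ U}, g (X t ω) ∂P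
      ≤ ε * P.real {ω | ∃ k < N, X (τ k) ω ∈ U} := by
  set ℱ := Filtration.natural X (fun i => (hX.measurable i).stronglyMeasurable)
  induction N with
  | zero => simp
  | succ N ih =>
    set A := {ω | ∃ k < N, X (τ k) ω ∈ U} with hA
    -- Paths whose first visit to U along the grid is at time τ_N. This event is known by time τ_N,
    -- so the Markov property replaces g(X_t) by T_{t-τ_N} g at a point of U.
    set B := X (τ N) ⁻¹' U \ A with hB
    have hAm : MeasurableSet[ℱ (τ N)] A :=
      hX.measurableSet_exists_mem hU fun k hk => hτ hk.le
    have hBm : MeasurableSet[ℱ (τ N)] B :=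
      ((Filtration.stronglyAdapted_natural
        (fun i => (hX.measurable i).stronglyMeasurable) (τ N)).measurable hU).diff hAm
    have hBm' := ℱ.le _ _ hBm
    have hdisj : Disjoint A B := disjoint_sdiff_self_right
    have hAB : {ω | ∃ k < N + 1, X (τ k) ω ∈ U} = A ∪ B := by
      rw [hB, union_sdiff_self]
      ext ω
      simp only [hA, mem_ofPred_eq, mem_union, mem_preimage, Nat.lt_succ_iff_lt_or_eq]
      constructor
      · rintro ⟨k, hk | rfl, h⟩
        · exact Or.inl ⟨k, hk, h⟩
        · exact Or.inr h
      · rintro (⟨k, hk, h⟩ | h)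
        · exact ⟨k, Or.inl hk, h⟩
        · exact ⟨N, Or.inr rfl, h⟩
    have hBle : ∫ ω in B, g (X t ω) ∂P ≤ ε * P.real B := by
      obtain ⟨r, hr⟩ := exists_add_of_le (hN N N.lt_succ_self)
      rw [hr, hX.setIntegral_op (τ N) r g hBm, mul_comm, ← smul_eq_mul, ← setIntegral_const]
      refine setIntegral_mono_on (hX.integrable_comp _ _).integrableOn
        (integrable_const _).integrableOn hBm' fun ω hω => ?_
      exact hε r (hr ▸ le_add_self) _ hω.1
    rw [hAB, setIntegral_union hdisj hBm' (hX.integrable_comp g t).integrableOn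
      (hX.integrable_comp g t).integrableOn, measureReal_union hdisj hBm', mul_add]
    exact add_le_add (ih fun k hk => hN k (hk.trans N.lt_succ_self)) hBle

/-- If `g ≥ 0` and `T_r g` vanishes at `z` for every `r`, then `g(X_t) = 0` almost surely on the
event that `X` has visited `z` by time `t`. -/
lemma ae_eq_zero_of_exists_eq {g : C(unitInterval, ℝ)} (hg : 0 ≤ g) {z : unitInterval}
    (hz : ∀ r, T.op r g z = 0) (t : ℝ≥0) :
    ∀ᵐ ω ∂P, (∃ s ≤ t, X s ω = z) → g (X t ω) = 0 := by
  have hjoint : Continuous fun p : ℝ≥0 × unitInterval => T.op p.1 g p.2 :=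
    ((T.continuous_op g).comp continuous_fst).eval continuous_snd
  -- Joint continuity and compactness of [0,t] give a neighbourhood of z on which T_r g is small for
  -- all r ≤ t at once. Together with grid times this takes the place of the strong Markov property
  -- at the hitting time.
  have hU : ∀ j : ℕ, ∃ U : Set unitInterval, IsOpen U ∧ z ∈ U ∧
      ∀ r ≤ t, ∀ x ∈ U, T.op r g x ≤ 1 / ((j : ℝ) + 1) := by
    intro j
    have hpos : (0 : ℝ) < 1 / ((j : ℝ) + 1) := Nat.one_div_pos_of_nat
    obtain ⟨u, v, _, hv, hu, hzv, huv⟩ := generalized_tube_lemma (isCompact_Icc (a := 0) (b := t))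
      (isCompact_singleton (x := z)) (isOpen_Iio.preimage hjoint (t := Iio (1 / ((j : ℝ) + 1))))
      (by
        rintro ⟨r, x⟩ ⟨_, hx⟩
        rw [mem_singleton_iff] at hx
        simp only at hx
        subst hx
        simpa only [mem_preimage, mem_Iio, hz] using hpos)
    exact ⟨v, hv, hzv rfl, fun r hr x hx => (huv (mk_mem_prod (hu ⟨zero_le, hr⟩) hx)).le⟩
  choose U hUo hzU hUle using hU
  set τ : ℕ → ℕ → ℝ≥0 := fun n k => k / ((n : ℝ≥0) + 1) with hτ
  set N : ℕ → ℕ := fun n => ⌊t * ((n : ℝ≥0) + 1)⌋₊ + 1 with hN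
  have hτt : ∀ n, ∀ k < N n, τ n k ≤ t := fun n k hk => by
    rw [hτ, div_le_iff₀ (by positivity)]
    exact (Nat.cast_le.2 (Nat.lt_succ_iff.1 hk)).trans (Nat.floor_le zero_le)
  have hτm : ∀ n, Monotone (τ n) := fun n k l hkl => by
    simp only [hτ]
    gcongr
  set A : ℕ → ℕ → Set Ω := fun j n => {ω | ∃ k < N n, X (τ n k) ω ∈ U j} with hA
  have hAm : ∀ j n, MeasurableSet (A j n) := fun j n =>
    Filtration.le _ t _ (hX.measurableSet_exists_mem (hUo j).measurableSet (hτt n))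
  set G : Ω → ℝ≥0∞ := fun ω => ENNReal.ofReal (g (X t ω)) with hG
  have hGm : Measurable G := (g.continuous.measurable.comp (hX.measurable t)).ennreal_ofReal
  set φ : ℕ → Ω → ℝ≥0∞ := fun j ω => liminf (fun n => (A j n).indicator G ω) atTop with hφ
  have hφm : ∀ j, Measurable (φ j) := fun j => Measurable.liminf fun n => hGm.indicator (hAm j n)
  -- Fatou's lemma, with the grid estimate applied at each mesh.
  have hφle : ∀ j : ℕ, ∫⁻ ω, φ j ω ∂P ≤ ENNReal.ofReal (1 / ((j : ℝ) + 1)) := by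
    intro j
    refine (lintegral_liminf_le fun n => hGm.indicator (hAm j n)).trans ?_
    refine liminf_le_of_le (h := fun b hb => ?_)
    obtain ⟨n, hn⟩ := hb.exists
    refine hn.trans ?_
    rw [lintegral_indicator (hAm j n), ← ofReal_integral_eq_lintegral_ofReal
      (hX.integrable_comp g t).integrableOn (Eventually.of_forall fun ω => hg _)]
    refine ENNReal.ofReal_le_ofReal ((hX.setIntegral_exists_mem_le (hUo j).measurableSet (hUle j)
      (hτm n) (hτt n)).trans (mul_le_of_le_one_right (by positivity) measureReal_le_one))
  have hzero : ∫⁻ ω, ⨅ j, φ j ω ∂P = 0 := by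
    refine le_antisymm (ge_of_tendsto' (x := atTop) (f := fun j : ℕ =>
      ENNReal.ofReal (1 / ((j : ℝ) + 1))) ?_ fun j =>
        (lintegral_mono fun ω => iInf_le _ j).trans (hφle j)) zero_le
    simpa using ENNReal.tendsto_ofReal (tendsto_one_div_add_atTop_nhds_zero_nat (𝕜 := ℝ))
  rw [lintegral_eq_zero_iff (Measurable.iInf hφm)] at hzero
  filter_upwards [hzero] with ω hω
  rintro ⟨s, hst, hs⟩
  -- If the path is at z at time s, the grid times just below s converge to s, so by continuity the
  -- path is in U_j at such a time for all fine meshes.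
  have hGφ : G ω ≤ ⨅ j, φ j ω := by
    refine le_iInf fun j => ?_
    refine le_liminf_of_le (h := ?_)
    have hlim : Tendsto (fun n : ℕ => τ n ⌊s * ((n : ℝ≥0) + 1)⌋₊) atTop (𝓝 s) := by
      rw [← NNReal.tendsto_coe]
      have h1 : Tendsto (fun n : ℕ => (n : ℝ) + 1) atTop atTop :=
        tendsto_atTop_add_const_right _ _ tendsto_natCast_atTop_atTop
      refine ((tendsto_nat_floor_mul_div_atTop s.coe_nonneg).comp h1).congr fun n => ?_
      have h2 : ⌊s * ((n : ℝ≥0) + 1)⌋₊ = ⌊(s : ℝ) * ((n : ℝ) + 1)⌋₊ := by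
        refine (Nonneg.nat_floor_coe _).symm.trans (congrArg _ ?_)
        rfl
      simp only [Function.comp_apply, hτ, h2]
      push_cast
      rfl
    have h3 := ((hX.continuous ω).tendsto s).comp hlim
    rw [hs] at h3
    filter_upwards [h3 ((hUo j).mem_nhds (hzU j))] with n hn
    rw [indicator_of_mem]
    refine ⟨⌊s * ((n : ℝ≥0) + 1)⌋₊, Nat.lt_succ_iff.2 (Nat.floor_mono ?_), hn⟩
    gcongr
  have h0 : G ω = 0 := le_antisymm (hGφ.trans_eq hω) zero_le
  exact le_antisymm (ENNReal.ofReal_eq_zero.1 h0) (hg _)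

omit [IsProbabilityMeasure P] in
-- Paths are continuous, so the set of visiting times is closed and its infimum is attained; without
-- a visit the hitting time is ⊤.
lemma hittingAfter_le_iff_exists (z : unitInterval) (t : ℝ≥0) (ω : Ω) :
    hittingAfter X {z} 0 ω ≤ (t : WithTop ℝ≥0) ↔ ∃ s ≤ t, X s ω = z := by
  classical
  constructor
  · intro h
    by_cases hex : ∃ j, 0 ≤ j ∧ X j ω ∈ ({z} : Set unitInterval)
    · rw [hittingAfter, if_pos hex, WithTop.coe_le_coe] at h
      have hcl : IsClosed {i : ℝ≥0 | 0 ≤ i ∧ X i ω ∈ ({z} : Set unitInterval)} := by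
        simp only [zero_le, true_and]
        exact isClosed_singleton.preimage (hX.continuous ω)
      have hmem := hcl.csInf_mem hex (OrderBot.bddBelow _)
      exact ⟨_, h, hmem.2⟩
    · rw [hittingAfter, if_neg hex] at h
      exact absurd (top_le_iff.1 h) WithTop.coe_ne_top
  · rintro ⟨s, hs, hz⟩
    exact (hittingAfter_le_of_mem zero_le hz).trans (WithTop.coe_le_coe.2 hs)

end IsFellerDiffusion

/-! ### Strong stationary duality -/

namespace IsReflectingOrEntrance

variable {a b : ℝ → ℝ} {T T' : FellerSemigroup} (hT : IsReflectingOrEntrance a b T)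
include hT

lemma exists_link_intertwining
    (hgen : ∀ f g : C(unitInterval, ℝ), T.Generator f g →
      ∃ F G : C(unitInterval, ℝ), (F : unitInterval → ℝ) = link (stationaryMeasure a b) f ∧
        (G : unitInterval → ℝ) = link (stationaryMeasure a b) g ∧ T'.Generator F G) :
    ∃ L : C(unitInterval, ℝ) →L[ℝ] C(unitInterval, ℝ),
      (∀ f x, L f x = link (stationaryMeasure a b) f x) ∧
      ∀ t f, T'.op t (L f) = L (T.op t f) := by
  have hP := hT.isProbabilityMeasure_stationaryMeasure
  obtain ⟨L, hL⟩ := exists_linkCLM (Pi := stationaryMeasure a b) (T := T)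
    (fun x y hxy => hT.stationaryMeasure_Ioc_ne_zero hxy) (fun f g hfg => by
      obtain ⟨F, G, hF, -, -⟩ := hgen f g hfg
      rw [← hF]
      exact F.continuous)
  refine ⟨L, hL, FellerSemigroup.intertwining L fun f g hfg => ?_⟩
  obtain ⟨F, G, hF, hG, hFG⟩ := hgen f g hfg
  rwa [show L f = F from ContinuousMap.ext fun x => (hL f x).trans (congrFun hF x).symm,
    show L g = G from ContinuousMap.ext fun x => (hL g x).trans (congrFun hG x).symm]

variable {L : C(unitInterval, ℝ) →L[ℝ] C(unitInterval, ℝ)}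
  (hL : ∀ f x, L f x = link (stationaryMeasure a b) f x)
include hL

/-- The dual process is absorbed at `1`. -/
lemma dual_ae_eq_one (hint : ∀ t f, T'.op t (L f) = L (T.op t f))
    {Ω : Type*} [MeasurableSpace Ω] {P : Measure Ω}
    [IsProbabilityMeasure P] {X : ℝ≥0 → Ω → unitInterval} (hX : IsFellerDiffusion T' P X)
    (t : ℝ≥0) : ∀ᵐ ω ∂P, (∃ s ≤ t, X s ω = 1) → X t ω = 1 := by
  have hP := hT.isProbabilityMeasure_stationaryMeasure
  have h0 := stationaryMeasure_singleton_zero a b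
  -- Any strictly increasing continuous f would do; the identity makes Λf(x) < Λf(1) for x < 1.
  set f : C(unitInterval, ℝ) := ⟨fun x => (x : ℝ), by fun_prop⟩ with hf
  set g : C(unitInterval, ℝ) := L f 1 • 1 - L f with hg
  have hgx : ∀ x, g x = L f 1 - L f x := fun x => by simp [hg]
  have hlt : ∀ x : unitInterval, x < 1 → 0 < g x := fun x hx => by
    rw [hgx, hL, hL]
    exact sub_pos.2 (link_val_lt (fun x y hxy => hT.stationaryMeasure_Ioc_ne_zero hxy) h0 hx)
  have hg1 : g 1 = 0 := by rw [hgx, sub_self]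
  have hg0 : 0 ≤ g := fun x =>
    (unitInterval.le_one' (t := x)).lt_or_eq.elim (fun h => (hlt x h).le) fun h => by
      rw [h]; exact hg1.ge
  have hz : ∀ r, T'.op r g 1 = 0 := fun r => by
    have h1 : T'.op r g 1 = L f 1 - L (T.op r f) 1 := by
      rw [hg, map_sub, map_smul, T'.op_one, hint]
      simp
    rw [h1, hL, hL, link_one h0, link_one h0, hT.isStationary.2, sub_self]
  filter_upwards [hX.ae_eq_zero_of_exists_eq hg0 hz t] with ω hω hex
  by_contra hne
  exact (hlt _ (lt_of_le_of_ne unitInterval.le_one' hne)).ne' (hω hex)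

/-- The dual process does not charge `0` at positive times. -/
lemma dual_law_zero {μ ν : ℝ≥0 → Measure unitInterval} [∀ t, IsProbabilityMeasure (μ t)]
    [∀ t, IsProbabilityMeasure (ν t)]
    (hμ : ∀ s r (f : C(unitInterval, ℝ)), ∫ x, f x ∂(μ (s + r)) = ∫ x, T.op r f x ∂(μ s))
    (hμν : ∀ t (f : C(unitInterval, ℝ)), ∫ x, f x ∂(μ t) = ∫ x, L f x ∂(ν t))
    {t : ℝ≥0} (ht : 0 < t) : ν t {0} = 0 := by
  have hP := hT.isProbabilityMeasure_stationaryMeasure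
  obtain ⟨r, hrt, hr⟩ := hT.exists_tendsto_op_spike ht
  obtain ⟨s, rfl⟩ : ∃ s, t = s + r := ⟨t - r, (tsub_add_cancel_of_le hrt).symm⟩
  have hnn : ∀ n, 0 ≤ T.op r (spike n) := fun n => T.op_nonneg r _ (spike_nonneg n)
  -- At x = 0 the link evaluates at 0, where r was chosen to give the limit. For x > 0, stationarity
  -- bounds the average over (0,x] by ∫ spike_n dΠ / Π(0,x].
  have hpt : ∀ x, Tendsto (fun n => L (T.op r (spike n)) x) atTop (𝓝 0) := by
    intro x
    rcases eq_or_ne x 0 with rfl | hx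
    · refine hr.congr fun n => ?_
      rw [hL, link_zero]
    · have hle : ∀ n, L (T.op r (spike n)) x
          ≤ (stationaryMeasure a b (Ioc 0 x))⁻¹.toReal *
            ∫ y, spike n y ∂(stationaryMeasure a b) := fun n => by
        rw [hL, link, truncated_of_ne hx, ProbabilityTheory.cond, integral_smul_measure,
          smul_eq_mul, ← hT.isStationary.2 r (spike n)]
        exact mul_le_mul_of_nonneg_left (setIntegral_le_integral (integrable_continuousMap _ _)
          (Eventually.of_forall (hnn n))) ENNReal.toReal_nonneg
      have h0 := (tendsto_integral_spike _ (stationaryMeasure_singleton_zero a b)).const_mul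
        (stationaryMeasure a b (Ioc 0 x))⁻¹.toReal
      rw [mul_zero] at h0
      exact squeeze_zero (fun n => by rw [hL]; exact integral_nonneg (hnn n)) hle h0
  have hlim : Tendsto (fun n => ∫ x, L (T.op r (spike n)) x ∂(ν s)) atTop (𝓝 0) := by
    have h := tendsto_integral_of_dominated_convergence (μ := ν s)
      (F := fun n x => L (T.op r (spike n)) x) (f := fun _ => 0) (fun _ => (1 : ℝ))
      (fun n => (L (T.op r (spike n))).continuous.aestronglyMeasurable) (integrable_const _)
      (fun n => Eventually.of_forall fun x => by
        rw [hL]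
        exact (abs_link_le (fun x y hxy => hT.stationaryMeasure_Ioc_ne_zero hxy) _ x).trans
          ((T.norm_op_le _ _).trans (norm_spike_le n)))
      (Eventually.of_forall hpt)
    simpa using h
  -- L(spike_n) is nonnegative and equals 1 at 0, so its ν_{s+r}-integral bounds the atom. That
  -- integral is carried to the primal law, moved back in time by r, and returned to the dual law at
  -- time s.
  have hle : ∀ n, (ν (s + r)).real {0} ≤ ∫ x, L (T.op r (spike n)) x ∂(ν s) := fun n => by
    rw [← hμν, ← hμ, hμν]
    have h1 : ∫ x in {0}, L (spike n) x ∂(ν (s + r)) = (ν (s + r)).real {0} := by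
      rw [integral_singleton, hL, link_zero, spike_zero, smul_eq_mul, mul_one]
    rw [← h1]
    exact setIntegral_le_integral (integrable_continuousMap _ _) (Eventually.of_forall fun x => by
      change 0 ≤ L (spike n) x
      rw [hL]
      exact integral_nonneg (spike_nonneg n))
  have h2 : (ν (s + r)).real {0} = 0 :=
    le_antisymm (ge_of_tendsto' hlim hle) measureReal_nonneg
  exact (measureReal_eq_zero_iff).1 h2

end IsReflectingOrEntrance

end SSD

/-! ### Separation as the tail of the dual hitting time -/

theorem mainTheorem3
    (a b : ℝ → ℝ) (T T' : SSD.FellerSemigroup)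
    (hT : SSD.IsReflectingOrEntrance a b T)
    {Ω : Type*} [MeasurableSpace Ω] (P : Measure Ω) [IsProbabilityMeasure P]
    (X : ℝ≥0 → Ω → unitInterval) (hX : SSD.IsFellerDiffusion T P X)
    {Ω' : Type*} [MeasurableSpace Ω'] (P' : Measure Ω') [IsProbabilityMeasure P']
    (X' : ℝ≥0 → Ω' → unitInterval) (hX' : SSD.IsFellerDiffusion T' P' X')
    (hdual : SSD.IsStrongStationaryDual T T' (SSD.stationaryMeasure a b)
      (P.map (X 0)) (P'.map (X' 0))) :
    SSD.IsStationary T (SSD.stationaryMeasure a b) ∧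
    ∀ t : ℝ≥0, 0 < t →
      P.map (X t) ≪ SSD.stationaryMeasure a b ∧
      SSD.separation (P.map (X t)) (SSD.stationaryMeasure a b)
        = P'.real {ω | (t : WithTop ℝ≥0) < hittingAfter X' {1} 0 ω} ∧
      P'.real {ω | (t : WithTop ℝ≥0) < hittingAfter X' {1} 0 ω}
        = 1 - P'.real {ω | X' t ω = 1} := by
  refine ⟨hT.isStationary, fun t ht => ?_⟩
  have hP := hT.isProbabilityMeasure_stationaryMeasure
  have hpos : ∀ x y : unitInterval, x < y → SSD.stationaryMeasure a b (Ioc x y) ≠ 0 :=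
    fun x y hxy => hT.stationaryMeasure_Ioc_ne_zero hxy
  have h0 := SSD.stationaryMeasure_singleton_zero a b
  obtain ⟨L, hL, hint⟩ := hT.exists_link_intertwining hdual.generator_link
  have hμp : ∀ t, IsProbabilityMeasure (P.map (X t)) := fun t =>
    Measure.isProbabilityMeasure_map (hX.measurable t).aemeasurable
  have hνp : ∀ t, IsProbabilityMeasure (P'.map (X' t)) := fun t =>
    Measure.isProbabilityMeasure_map (hX'.measurable t).aemeasurable
  have hμν : ∀ t (f : C(unitInterval, ℝ)),
      ∫ x, f x ∂(P.map (X t)) = ∫ x, L f x ∂(P'.map (X' t)) := fun t f => by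
    rw [hX.integral_law, hX'.integral_law, hint, hdual.initial_link _
      (T.op t f).continuous.measurable ⟨‖T.op t f‖, (T.op t f).norm_coe_le_norm⟩]
    simp only [hL]
  have hμ : ∀ s r (f : C(unitInterval, ℝ)),
      ∫ x, f x ∂(P.map (X (s + r))) = ∫ x, T.op r f x ∂(P.map (X s)) := fun s r f => by
    rw [hX.integral_law (s + r), hX.integral_law s, T.op_add, ContinuousLinearMap.comp_apply]
  have hν0 : P'.map (X' t) {0} = 0 :=
    hT.dual_law_zero hL (μ := fun t => P.map (X t)) (ν := fun t => P'.map (X' t)) hμ hμν ht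
  have hbind := SSD.eq_bind_truncated hpos hL (hμν t)
  have hhit : P'.real {ω | (t : WithTop ℝ≥0) < hittingAfter X' {1} 0 ω}
      = 1 - P'.real {ω | X' t ω = 1} := by
    have hm : MeasurableSet {ω | X' t ω = 1} := hX'.measurable t (measurableSet_singleton 1)
    rw [← probReal_compl_eq_one_sub hm]
    refine measureReal_congr ?_
    filter_upwards [hT.dual_ae_eq_one hL hint hX' t] with ω hω
    refine propext ?_
    change (t : WithTop ℝ≥0) < hittingAfter X' {1} 0 ω ↔ ¬X' t ω = 1
    rw [← not_le, hX'.hittingAfter_le_iff_exists]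
    -- Absorption gives one implication; for the other, t itself is a visiting time.
    exact not_congr ⟨hω, fun h => ⟨t, le_rfl, h⟩⟩
  refine ⟨hbind ▸ SSD.bind_truncated_absolutelyContinuous hν0, ?_, hhit⟩
  have : IsFiniteMeasure ((P'.map (X' t)).bind (SSD.truncated (SSD.stationaryMeasure a b))) :=
    hbind ▸ inferInstance
  rw [hhit, SSD.separation, hbind, SSD.essInf_rnDeriv_bind_truncated hpos h0 hν0,
    Measure.map_apply (hX'.measurable t) (measurableSet_singleton 1)]
  rfl
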